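/- For $\operatorname{Re} x>0$ let $\theta_3(x)=\sum_{n=-\infty}^{\infty}e^{-\pi n^2x}$, for $|z|<1$ let $$\sigma_3(z)=\frac{1}{\sqrt{1+z}}\,\theta_3\!\left(\frac{1-z}{1+z}\right)$$ (principal branch of the square root), and let $\Phi=\dfrac{\Gamma(1/4)^8}{128\,\pi^4}$. Let $(d(n))_{n\ge 0}$ be the sequence of normalised Taylor coefficients of the even function $\sigma_3$ at $0$, defined by $$\sigma_3(z)=\theta_3(1)\sum_{n=0}^\infty\frac{d(n)}{(2n)!}\,\Phi^n z^{2n}\qquad(|z|<1),$$ that is, $d(n)=\sigma_3^{(2n)}(0)/(\theta_3(1)\,\Phi^n)$. Then the series $$\widehat\sigma_3(z)=\sum_{n=0}^\infty\frac{d(n)}{(2n)!}\,z^{2n}$$ converges for every complex $z$ with $|z|<\sqrt\Phi$, its sum equals $\frac{1}{\theta_3(1)}\,\sigma_3\!\left(z/\sqrt\Phi\right)$ there, the function $\widehat\sigma_3$ is holomorphic on this disk, and $y=\widehat\sigma_3(z)$ satisfies on the whole disk $|z|<\sqrt\Phi$ the differential equation $$\bigl(y^2y'''-15\,y\,y'y''+30(y')^3\bigr)^2+32\bigl(y\,y''-3(y')^2\bigr)^3=32\,y^{10}\bigl(y\,y''-3(y')^2\bigr)^2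 .$$ -/

import Mathlib

noncomputable section

/-- The theta constant `θ₃(x) = ∑_{n ∈ ℤ} exp(-π n² x)`, for `Re x > 0`. -/
def theta3 (x : ℂ) : ℂ :=
  ∑' n : ℤ, Complex.exp (-(Real.pi : ℂ) * (n : ℂ) ^ 2 * x)

/-- The centred theta constant `σ₃(z) = (1 + z)^(-1/2) θ₃((1 - z)/(1 + z))`, for `|z| < 1`,
with the principal branch of the square root (note `Re (1 + z) > 0`). -/
def sigma3 (z : ℂ) : ℂ :=
  1 / (1 + z) ^ (1 / 2 : ℂ) * theta3 ((1 - z) / (1 + z))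

/-- The constant `Φ = Γ(1/4)⁸ / (128 π⁴)`. -/
def thetaPhi : ℝ := Real.Gamma (1 / 4) ^ 8 / (128 * Real.pi ^ 4)

/-- The numbers `d(n)`, normalised Taylor coefficients of `σ₃` at `0`: they are determined by
`σ₃(z) = θ₃(1) ∑ d(n) / (2n)! Φⁿ z²ⁿ` for `|z| < 1`. -/
def thetaD (n : ℕ) : ℂ :=
  iteratedDeriv (2 * n) sigma3 0 / (theta3 1 * (thetaPhi : ℂ) ^ n)

/-- The generating function `σ̂₃(z) = ∑ d(n) z²ⁿ / (2n)!`, for `|z| < √Φ`. -/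
def sigmaHat3 (z : ℂ) : ℂ :=
  ∑' n : ℕ, thetaD n / ((2 * n).factorial : ℂ) * z ^ (2 * n)

end

open Filter Topology Asymptotics MeasureTheory Set

/-! Let `f`, `g`, `h` be the logarithmic derivatives of θ₂, θ₃, θ₄ in `x`. They satisfy a
Darboux–Halphen system (`isHalphenAt_theta`), which is covariant under Möbius changes of variable
(`IsHalphenAt.comp`). The Cayley transform therefore carries it to the disk, where the new `g` is
the logarithmic derivative of `y = sigmaHat3`.

The system makes the equation an algebraic identity. With A = yy'' − 3y'² one gets A =
−2y²(g−f)(g−h), and the cubic expression inside the square is yA' − 10y'A = 4yA(f+h−2g). The left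
side is then 16y²A²[(f+h−2g)² − 4(g−f)(g−h)] = 16y²A²(f−h)². What remains is (f−h)² = 2y⁸: Jacobi's
formula f − h = −(π/4)θ₃⁴ on the half-plane, plus a constant fixed by π²θ₃(1)⁸ = 8Φ.

The theta identities need no modular forms. One lattice splitting (`theta3_two_mul_sq`) yields all
duplication formulas. Each differential identity is shown to be compatible with x ↦ 2x and is then
settled by the asymptotics as Re x → ∞. The value θ₃(1) comes from the arithmetic-geometric mean:
θ₃², θ₄² perform one AGM step when `x` doubles, so an elliptic integral is constant in `x`; at x = 1
it is a lemniscatic Beta integral. -/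

/-! ### The theta series: inversion and tail bound -/

theorem theta3_eq_jacobiTheta (x : ℂ) : theta3 x = jacobiTheta (Complex.I * x) := by
  unfold theta3 jacobiTheta
  refine tsum_congr fun n => ?_
  congr 1
  linear_combination (-(Real.pi : ℂ) * (n : ℂ) ^ 2 * x) * Complex.I_sq

theorem I_mul_im_pos {x : ℂ} (hx : 0 < x.re) : 0 < (Complex.I * x).im := by simpa using hx

theorem differentiableAt_theta3 {x : ℂ} (hx : 0 < x.re) : DifferentiableAt ℂ theta3 x := by
  have h : theta3 = fun x => jacobiTheta (Complex.I * x) := funext theta3_eq_jacobiTheta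
  rw [h]
  exact (differentiableAt_jacobiTheta (I_mul_im_pos hx)).comp x
    ((differentiableAt_const _).mul differentiableAt_id)

theorem theta3_inv {x : ℂ} (hx : 0 < x.re) : theta3 x⁻¹ = x ^ (1 / 2 : ℂ) * theta3 x := by
  have h := jacobiTheta_S_smul ⟨Complex.I * x, I_mul_im_pos hx⟩
  rw [UpperHalfPlane.modular_S_smul] at h
  simp only at h
  rw [theta3_eq_jacobiTheta, theta3_eq_jacobiTheta]
  have e1 : (-(Complex.I * x))⁻¹ = Complex.I * x⁻¹ := by
    rw [← neg_mul, mul_inv, inv_neg, Complex.inv_I, neg_neg]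
  have e2 : -Complex.I * (Complex.I * x) = x := by
    linear_combination (-x) * Complex.I_sq
  rw [e1, e2] at h
  exact h

theorem summable_norm_theta3_term {x : ℂ} (hx : 0 < x.re) :
    Summable fun n : ℤ => ‖Complex.exp (-(Real.pi : ℂ) * (n : ℂ) ^ 2 * x)‖ := by
  have h := (hasSum_jacobiTheta₂_term 0 (I_mul_im_pos hx)).summable.norm
  refine h.congr fun n => ?_
  unfold jacobiTheta₂_term
  congr 2
  linear_combination (Real.pi : ℂ) * (n : ℂ) ^ 2 * x * Complex.I_sq

/-- The exponential series for `θ₃` after the first two orders. -/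
theorem norm_theta3_sub_le {x : ℂ} (hx : 0 < x.re) :
    ‖theta3 x - 1 - 2 * Complex.exp (-Real.pi * x)‖ ≤
      2 / (1 - Real.exp (-Real.pi * x.re)) * Real.exp (-Real.pi * x.re) ^ 4 := by
  have h := hasSum_nat_jacobiTheta (I_mul_im_pos hx)
  rw [← theta3_eq_jacobiTheta] at h
  set r := Real.exp (-Real.pi * x.re) with hr
  have hr0 : 0 < r := Real.exp_pos _
  have hr1 : r < 1 := by
    rw [hr, Real.exp_lt_one_iff]
    nlinarith [Real.pi_pos]
  have h1 := (hasSum_nat_add_iff' 1).2 h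
  have hb : ∀ n : ℕ, ‖Complex.exp (Real.pi * Complex.I * (((n + 1 : ℕ) : ℂ) + 1) ^ 2 *
      (Complex.I * x))‖ ≤ r ^ 4 * r ^ n := by
    intro n
    have e : Complex.exp (Real.pi * Complex.I * (((n + 1 : ℕ) : ℂ) + 1) ^ 2 * (Complex.I * x))
        = Complex.exp (-Real.pi * x) ^ ((n + 2) ^ 2) := by
      rw [← Complex.exp_nat_mul]
      congr 1
      push_cast
      linear_combination (Real.pi : ℂ) * ((n : ℂ) + 2) ^ 2 * x * Complex.I_sq
    have e2 : ‖Complex.exp (-Real.pi * x)‖ = r := by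
      rw [Complex.norm_exp, hr]
      simp
    rw [e, norm_pow, e2, ← pow_add]
    -- (n+2)² ≥ n+4 compares the tail with a geometric series.
    exact pow_le_pow_of_le_one hr0.le hr1.le (by nlinarith)
  have hg : HasSum (fun n : ℕ => r ^ 4 * r ^ n) (r ^ 4 * (1 - r)⁻¹) :=
    (hasSum_geometric_of_lt_one hr0.le hr1).mul_left _
  have h2 := h1.norm_le_of_bounded hg hb
  have e : theta3 x - 1 - 2 * Complex.exp (-Real.pi * x) = 2 * ((theta3 x - 1) / 2 -
      ∑ i ∈ Finset.range 1, Complex.exp (Real.pi * Complex.I * ((i : ℂ) + 1) ^ 2 *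
        (Complex.I * x))) := by
    have : (Real.pi : ℂ) * Complex.I * (((0 : ℕ) : ℂ) + 1) ^ 2 * (Complex.I * x)
        = -Real.pi * x := by
      push_cast
      linear_combination (Real.pi : ℂ) * x * Complex.I_sq
    rw [Finset.sum_range_one, this]
    ring
  rw [e, norm_mul, Complex.norm_two]
  calc _ ≤ 2 * (r ^ 4 * (1 - r)⁻¹) := by gcongr
    _ = _ := by ring

/-! ### Parity splittings and the basic quadratic identity -/

/-- Splitting pairs of integers by the parity of their sum. -/
def intPairParityEquiv : (ℤ × ℤ) ⊕ (ℤ × ℤ) ≃ ℤ × ℤ where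
  toFun := Sum.elim (fun p => (p.1 + p.2, p.1 - p.2)) (fun p => (p.1 + p.2 + 1, p.1 - p.2))
  invFun p := if (p.1 + p.2) % 2 = 0 then Sum.inl ((p.1 + p.2) / 2, (p.1 - p.2) / 2)
    else Sum.inr ((p.1 + p.2 - 1) / 2, (p.1 - p.2 - 1) / 2)
  left_inv := by
    rintro (⟨a, b⟩ | ⟨a, b⟩)
    · have h : (a + b + (a - b)) % 2 = 0 := by omega
      simp only [Sum.elim_inl, h, if_true]
      congr 2 <;> omega
    · have h : ¬ (a + b + 1 + (a - b)) % 2 = 0 := by omega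
      simp only [Sum.elim_inr, h, if_false]
      congr 2 <;> omega
  right_inv := by
    rintro ⟨a, b⟩
    by_cases h : (a + b) % 2 = 0
    · simp only [h, if_true, Sum.elim_inl]
      congr 1 <;> omega
    · simp only [h, if_false, Sum.elim_inr]
      congr 1 <;> omega

/-- Splitting the integers by parity. -/
def intParityEquiv : ℤ ⊕ ℤ ≃ ℤ where
  toFun := Sum.elim (fun n => 2 * n) (fun n => 2 * n + 1)
  invFun n := if n % 2 = 0 then Sum.inl (n / 2) else Sum.inr ((n - 1) / 2)
  left_inv := by
    rintro (a | a)
    · simp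
    · have h : ¬ (2 * a + 1) % 2 = 0 := by omega
      simp only [Sum.elim_inr, h, if_false]
      congr 1
      omega
  right_inv := by
    intro a
    by_cases h : a % 2 = 0
    · simp only [h, if_true, Sum.elim_inl]
      omega
    · simp only [h, if_false, Sum.elim_inr]
      omega

theorem hasSum_theta3 {x : ℂ} (hx : 0 < x.re) :
    HasSum (fun n : ℤ => Complex.exp (-(Real.pi : ℂ) * (n : ℂ) ^ 2 * x)) (theta3 x) :=
  (summable_norm_theta3_term hx).of_norm.hasSum

/-- The sum over odd integers of `exp (-π n² x)`. -/
theorem hasSum_theta3_odd {x : ℂ} (hx : 0 < x.re) :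
    HasSum (fun n : ℤ => Complex.exp (-(Real.pi : ℂ) * (2 * n + 1 : ℂ) ^ 2 * x))
      (theta3 x - theta3 (4 * x)) ∧
    Summable fun n : ℤ => ‖Complex.exp (-(Real.pi : ℂ) * (2 * n + 1 : ℂ) ^ 2 * x)‖ := by
  have hs : Summable fun n : ℤ => ‖Complex.exp (-(Real.pi : ℂ) * (2 * n + 1 : ℂ) ^ 2 * x)‖ := by
    have := (summable_norm_theta3_term hx).comp_injective
      (i := fun n : ℤ => 2 * n + 1) (fun a b h => by simpa using h)
    refine this.congr fun n => ?_
    simp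
  refine ⟨?_, hs⟩
  have h4 : 0 < (4 * x).re := by simpa using hx
  set F : ℤ ⊕ ℤ → ℂ := fun s => Complex.exp (-(Real.pi : ℂ) * (intParityEquiv s : ℂ) ^ 2 * x)
    with hF
  have he : HasSum (F ∘ Sum.inl) (theta3 (4 * x)) := by
    refine (hasSum_theta3 h4).congr_fun fun n => ?_
    simp only [hF, Function.comp, intParityEquiv, Equiv.coe_fn_mk, Sum.elim_inl]
    push_cast
    ring_nf
  have ho : HasSum (F ∘ Sum.inr)
      (∑' n : ℤ, Complex.exp (-(Real.pi : ℂ) * (2 * n + 1 : ℂ) ^ 2 * x)) := by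
    refine hs.of_norm.hasSum.congr_fun fun n => ?_
    simp only [hF, Function.comp, intParityEquiv, Equiv.coe_fn_mk, Sum.elim_inr]
    push_cast
    ring_nf
  have := (he.sum ho).unique (intParityEquiv.hasSum_iff.2 (hasSum_theta3 hx))
  rw [← this, add_sub_cancel_left]
  exact hs.of_norm.hasSum

theorem hasSum_prod_mul_of_summable_norm {ι : Type*} {f : ι → ℂ} {a : ℂ} (hf : HasSum f a)
    (hs : Summable fun i => ‖f i‖) : HasSum (fun p : ι × ι => f p.1 * f p.2) (a ^ 2) := by
  rw [sq]
  exact hf.mul hf (summable_mul_of_summable_norm hs hs)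

/-- Split ℤ² by the parity of the coordinate sum: (m+n)² + (m−n)² = 2(m²+n²) on one class, and
(m+n+1)² + (m−n)² = ((2m+1)² + (2n+1)²)/2 on the other. The two classes give the two squares. -/
theorem theta3_two_mul_sq {x : ℂ} (hx : 0 < x.re) :
    theta3 (2 * x) ^ 2 = theta3 (4 * x) ^ 2 + (theta3 x - theta3 (4 * x)) ^ 2 := by
  have h2 : 0 < (2 * x).re := by simpa using hx
  have h4 : 0 < (4 * x).re := by simpa using hx
  obtain ⟨ho, hos⟩ := hasSum_theta3_odd hx
  have he := hasSum_theta3 h4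
  have hes := summable_norm_theta3_term h4
  have hL := hasSum_prod_mul_of_summable_norm (hasSum_theta3 h2) (summable_norm_theta3_term h2)
  have hE := hasSum_prod_mul_of_summable_norm he hes
  have hO := hasSum_prod_mul_of_summable_norm ho hos
  set F : ℤ × ℤ → ℂ := fun p => Complex.exp (-(Real.pi : ℂ) * (p.1 : ℂ) ^ 2 * (2 * x)) *
    Complex.exp (-(Real.pi : ℂ) * (p.2 : ℂ) ^ 2 * (2 * x)) with hF
  have h1 : HasSum ((F ∘ intPairParityEquiv) ∘ Sum.inl) (theta3 (4 * x) ^ 2) := by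
    refine hE.congr_fun fun p => ?_
    simp only [hF, Function.comp, intPairParityEquiv, Equiv.coe_fn_mk, Sum.elim_inl]
    rw [← Complex.exp_add, ← Complex.exp_add]
    push_cast
    ring_nf
  have h2 : HasSum ((F ∘ intPairParityEquiv) ∘ Sum.inr)
      ((theta3 x - theta3 (4 * x)) ^ 2) := by
    refine hO.congr_fun fun p => ?_
    simp only [hF, Function.comp, intPairParityEquiv, Equiv.coe_fn_mk, Sum.elim_inr]
    rw [← Complex.exp_add, ← Complex.exp_add]
    push_cast
    ring_nf
  exact (intPairParityEquiv.hasSum_iff.2 hL).unique (h1.sum h2)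

/-- The theta constant `θ₂`, as the sum over odd half-integers. -/
noncomputable def theta2 (x : ℂ) : ℂ := theta3 (x / 4) - theta3 x

/-- The theta constant `θ₄`, the alternating companion of `θ₃`. -/
noncomputable def theta4 (x : ℂ) : ℂ := 2 * theta3 (4 * x) - theta3 x

theorem differentiableAt_theta2 {x : ℂ} (hx : 0 < x.re) : DifferentiableAt ℂ theta2 x := by
  have h : 0 < (x / 4).re := by simpa using hx
  exact ((differentiableAt_theta3 h).comp x (differentiableAt_id.div_const (4 : ℂ))).sub
    (differentiableAt_theta3 hx)

theorem differentiableAt_theta4 {x : ℂ} (hx : 0 < x.re) : DifferentiableAt ℂ theta4 x := by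
  have h : 0 < (4 * x).re := by simpa using hx
  exact (((differentiableAt_theta3 h).comp x (differentiableAt_id.const_mul (4 : ℂ))).const_mul 2).sub
    (differentiableAt_theta3 hx)

/-! ### Duplication formulas and Jacobi's quartic identity -/

section Duplication

variable {x : ℂ}

theorem theta3_sq_add_theta4_sq (hx : 0 < x.re) :
    theta3 x ^ 2 + theta4 x ^ 2 = 2 * theta3 (2 * x) ^ 2 := by
  rw [theta3_two_mul_sq hx, theta4]
  ring

theorem theta3_sq_eq (hx : 0 < x.re) :
    theta3 x ^ 2 = theta3 (2 * x) ^ 2 + theta2 (2 * x) ^ 2 := by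
  have h := theta3_two_mul_sq (x := x / 2) (by simpa using hx)
  have e1 : 2 * (x / 2) = x := by ring
  have e2 : 4 * (x / 2) = 2 * x := by ring
  have e3 : 2 * x / 4 = x / 2 := by ring
  rw [e1, e2] at h
  rw [h, theta2, e3]

theorem theta4_sq_eq (hx : 0 < x.re) :
    theta4 x ^ 2 = theta3 (2 * x) ^ 2 - theta2 (2 * x) ^ 2 := by
  linear_combination theta3_sq_add_theta4_sq hx - theta3_sq_eq hx

theorem theta3_mul_theta4 (hx : 0 < x.re) : theta3 x * theta4 x = theta4 (2 * x) ^ 2 := by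
  have h1 := theta3_two_mul_sq hx
  have h2 := theta3_two_mul_sq (x := 2 * x) (by simpa using hx)
  have e1 : 2 * (2 * x) = 4 * x := by ring
  rw [e1] at h2
  rw [theta4, theta4]
  linear_combination h1 + 2 * h2

theorem theta2_sq_eq (hx : 0 < x.re) : theta2 x ^ 2 = 2 * theta2 (2 * x) * theta3 (2 * x) := by
  have h1 := theta3_two_mul_sq (x := x / 4) (by simpa using hx)
  have h2 := theta3_two_mul_sq (x := x / 2) (by simpa using hx)
  have e1 : 2 * (x / 4) = x / 2 := by ring
  have e2 : 4 * (x / 4) = x := by ring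
  have e3 : 2 * (x / 2) = x := by ring
  have e4 : 4 * (x / 2) = 2 * x := by ring
  have e5 : 2 * x / 4 = x / 2 := by ring
  rw [e1, e2] at h1
  rw [e3, e4] at h2
  rw [theta2, theta2, e5]
  linear_combination -h1 - h2

theorem theta3_pow_four_sub (hx : 0 < x.re) :
    theta3 x ^ 4 - theta4 x ^ 4 = theta2 x ^ 4 := by
  linear_combination (theta3 x ^ 2 + theta4 x ^ 2) * (theta3_sq_eq hx - theta4_sq_eq hx) +
    2 * theta2 (2 * x) ^ 2 * theta3_sq_add_theta4_sq hx -
    (theta2 x ^ 2 + 2 * theta2 (2 * x) * theta3 (2 * x)) * theta2_sq_eq hx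

end Duplication

/-! ### Exponential asymptotics as Re x → ∞ -/

section Decay

/-- The filter of complex numbers with real part tending to infinity. -/
abbrev reAtTop : Filter ℂ := comap Complex.re atTop

theorem eventually_reAtTop_lt (M : ℝ) : ∀ᶠ x in reAtTop, M < x.re :=
  tendsto_comap.eventually (eventually_gt_atTop M)

theorem isBigO_exp_reAtTop {c d : ℝ} (h : d ≤ c) :
    (fun x : ℂ => Real.exp (-c * x.re)) =O[reAtTop] fun x => Real.exp (-d * x.re) := by
  refine IsBigO.of_bound 1 ?_
  filter_upwards [eventually_reAtTop_lt 0] with x hx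
  rw [Real.norm_eq_abs, Real.norm_eq_abs, Real.abs_exp, Real.abs_exp, one_mul, Real.exp_le_exp]
  nlinarith

theorem tendsto_mul_reAtTop {k : ℝ} (hk : 0 < k) :
    Tendsto (fun x : ℂ => (k : ℂ) * x) reAtTop reAtTop := by
  rw [tendsto_comap_iff]
  have : Complex.re ∘ (fun x : ℂ => (k : ℂ) * x) = fun x => k * x.re := by
    ext x
    simp
  rw [this]
  exact tendsto_comap.const_mul_atTop hk

theorem isBigO_cexp_reAtTop (c : ℝ) :
    (fun x : ℂ => Complex.exp (c * x)) =O[reAtTop] fun x => Real.exp (-(-c) * x.re) := by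
  refine IsBigO.of_bound 1 (Eventually.of_forall fun x => ?_)
  rw [Complex.norm_exp, Real.norm_eq_abs, Real.abs_exp]
  simp

theorem isBigO_theta3_sub {k : ℝ} (hk : 0 < k) :
    (fun x => theta3 (k * x) - 1 - 2 * Complex.exp (-(Real.pi * k : ℝ) * x)) =O[reAtTop]
      fun x => Real.exp (-(4 * Real.pi * k) * x.re) := by
  have h : (fun x => theta3 x - 1 - 2 * Complex.exp (-Real.pi * x)) =O[reAtTop]
      fun x => Real.exp (-(4 * Real.pi) * x.re) := by
    refine IsBigO.of_bound (2 / (1 - Real.exp (-Real.pi))) ?_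
    filter_upwards [eventually_reAtTop_lt 1] with x hx
    refine (norm_theta3_sub_le (by linarith)).trans ?_
    have h1 : Real.exp (-Real.pi * x.re) ≤ Real.exp (-Real.pi) := by
      rw [Real.exp_le_exp]
      nlinarith [Real.pi_pos]
    have h2 : Real.exp (-Real.pi) < 1 := by
      rw [Real.exp_lt_one_iff]
      linarith [Real.pi_pos]
    have h3 : Real.exp (-Real.pi * x.re) ^ 4 = ‖Real.exp (-(4 * Real.pi) * x.re)‖ := by
      rw [← Real.exp_nat_mul, Real.norm_eq_abs, Real.abs_exp]
      congr 1
      push_cast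
      ring
    rw [h3]
    have : 0 < 1 - Real.exp (-Real.pi) := by linarith
    gcongr
  have h2 := h.comp_tendsto (tendsto_mul_reAtTop hk)
  refine (h2.congr_left fun x => ?_).congr_right fun x => ?_
  · simp only [Function.comp]
    push_cast
    ring_nf
  · simp only [Function.comp, Complex.re_ofReal_mul]
    ring_nf

theorem isBigO_theta3_sub_one {k : ℝ} (hk : 0 < k) :
    (fun x => theta3 (k * x) - 1) =O[reAtTop] fun x => Real.exp (-(Real.pi * k) * x.re) := by
  have h1 := (isBigO_theta3_sub hk).trans (isBigO_exp_reAtTop (d := Real.pi * k)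
    (by nlinarith [mul_pos Real.pi_pos hk]))
  have h2 := (isBigO_cexp_reAtTop (-(Real.pi * k))).const_mul_left 2
  rw [neg_neg] at h2
  refine (h1.add h2).congr_left fun x => ?_
  push_cast
  ring

/-- Exponential decay at rate one in the real part. -/
abbrev ExpDecay (g : ℂ → ℂ) : Prop := g =O[reAtTop] fun x => Real.exp (-1 * x.re)

theorem expDecay_theta3_sub_one : ExpDecay fun x => theta3 x - 1 := by
  have h := (isBigO_theta3_sub_one one_pos).trans (isBigO_exp_reAtTop (d := 1)
    (by linarith [Real.pi_gt_three]))
  simpa only [Complex.ofReal_one, one_mul] using h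

theorem expDecay_theta4_sub_one : ExpDecay fun x => theta4 x - 1 := by
  have h := (isBigO_theta3_sub_one (k := 4) (by norm_num)).trans (isBigO_exp_reAtTop (d := 1)
    (by linarith [Real.pi_gt_three]))
  refine ((h.const_mul_left 2).sub expDecay_theta3_sub_one).congr_left fun x => ?_
  rw [theta4]
  push_cast
  ring

/-- The leading term of θ₂ is 2exp(−πx/4), so θ₃(x/4) is needed to second order. After
multiplication by exp(πx/4) both errors have rate 3π/4, which exceeds 1. -/
theorem expDecay_exp_mul_theta2_sub :
    ExpDecay fun x => Complex.exp ((Real.pi / 4 : ℝ) * x) * theta2 x - 2 := by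
  have hp := Real.pi_gt_three
  have h1 := (isBigO_cexp_reAtTop (Real.pi / 4)).mul (isBigO_theta3_sub (k := 1 / 4) (by norm_num))
  have h2 := (isBigO_cexp_reAtTop (Real.pi / 4)).mul (isBigO_theta3_sub_one (k := 1) one_pos)
  simp only [← Real.exp_add, ← add_mul] at h1 h2
  have e1 : -(-(Real.pi / 4)) + -(4 * Real.pi * (1 / 4)) = -(3 / 4 * Real.pi) := by ring
  have e2 : -(-(Real.pi / 4)) + -(Real.pi * 1) = -(3 / 4 * Real.pi) := by ring
  rw [e1] at h1
  rw [e2] at h2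
  refine ((h1.sub h2).trans (isBigO_exp_reAtTop (d := 1) (by linarith))).congr_left fun x => ?_
  have e3 : Complex.exp ((Real.pi / 4 : ℝ) * x) * Complex.exp (-(Real.pi * (1 / 4) : ℝ) * x)
      = 1 := by
    rw [← Complex.exp_add, ← Complex.exp_zero]
    congr 1
    push_cast
    ring
  have e4 : ((1 / 4 : ℝ) : ℂ) * x = x / 4 := by
    push_cast
    ring
  rw [e4, theta2, Complex.ofReal_one, one_mul]
  linear_combination (-2) * e3

theorem ExpDecay.tendsto {g : ℂ → ℂ} (h : ExpDecay g) : Tendsto g reAtTop (𝓝 0) := by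
  refine h.trans_tendsto ?_
  have : Tendsto (fun x : ℝ => Real.exp (-1 * x)) atTop (𝓝 0) := by
    simpa using Real.tendsto_exp_neg_atTop_nhds_zero
  exact this.comp tendsto_comap

/-- Cauchy's estimate on the unit circle about `x`: the real part drops by at most 1, which costs a
factor e. -/
theorem ExpDecay.deriv {g : ℂ → ℂ} (h : ExpDecay g)
    (hd : ∀ x : ℂ, 0 < x.re → DifferentiableAt ℂ g x) : ExpDecay (deriv g) := by
  obtain ⟨C, hC⟩ := h.bound
  rw [eventually_comap, eventually_atTop] at hC
  obtain ⟨M, hM⟩ := hC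
  refine IsBigO.of_bound (|C| * Real.exp 1) ?_
  filter_upwards [eventually_reAtTop_lt (max M 0 + 1)] with x hx
  have hre : ∀ y ∈ Metric.closedBall x 1, x.re - 1 ≤ y.re := by
    intro y hy
    have := (Complex.abs_re_le_norm (y - x)).trans (mem_closedBall_iff_norm.1 hy)
    rw [Complex.sub_re, abs_le] at this
    linarith
  have h0 : ∀ y ∈ Metric.closedBall x 1, 0 < y.re := fun y hy => by
    linarith [hre y hy, le_max_right M 0]
  have hdc : DiffContOnCl ℂ g (Metric.ball x 1) := by
    refine DifferentiableOn.diffContOnCl_ball (U := {y : ℂ | 0 < y.re})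
      (fun y hy => (hd y hy).differentiableWithinAt) h0
  have hb : ∀ y ∈ Metric.sphere x 1, ‖g y‖ ≤ |C| * Real.exp 1 * Real.exp (-1 * x.re) := by
    intro y hy
    have hy' := hre y (Metric.sphere_subset_closedBall hy)
    refine (hM y.re (by linarith [le_max_left M 0]) y rfl).trans ?_
    rw [Real.norm_eq_abs, Real.abs_exp, mul_assoc, ← Real.exp_add]
    refine mul_le_mul (le_abs_self C) ?_ (Real.exp_pos _).le (abs_nonneg _)
    rw [Real.exp_le_exp]
    linarith
  have := Complex.norm_deriv_le_of_forall_mem_sphere_norm_le one_pos hdc hb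
  rwa [div_one, ← abs_of_pos (Real.exp_pos (-1 * x.re)), ← Real.norm_eq_abs] at this

theorem ExpDecay.logDeriv {g : ℂ → ℂ} {a : ℂ} (ha : a ≠ 0) (h : ExpDecay fun x => g x - a)
    (hd : ∀ x : ℂ, 0 < x.re → DifferentiableAt ℂ g x) : ExpDecay (logDeriv g) := by
  have h1 : ExpDecay (_root_.deriv g) := by
    have := h.deriv fun x hx => (hd x hx).sub_const a
    simpa only [deriv_sub_const_fun] using this
  have h2 : Tendsto g reAtTop (𝓝 a) := by simpa using h.tendsto.add_const a
  have h3 : (fun x => (g x)⁻¹) =O[reAtTop] fun _ => (1 : ℝ) := (h2.inv₀ ha).isBigO_one ℝ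
  have := h1.mul h3
  simp only [mul_one] at this
  exact this.congr_left fun x => by rw [logDeriv_apply, div_eq_mul_inv]

theorem tendsto_two_pow_mul_reAtTop {x : ℂ} (hx : 0 < x.re) :
    Tendsto (fun n : ℕ => (2 : ℂ) ^ n * x) atTop reAtTop := by
  rw [tendsto_comap_iff]
  have : Complex.re ∘ (fun n : ℕ => (2 : ℂ) ^ n * x) = fun n : ℕ => (2 : ℝ) ^ n * x.re := by
    ext n
    have : ((2 : ℂ) ^ n) = ((2 ^ n : ℝ) : ℂ) := by push_cast; rfl
    simp only [Function.comp, this, Complex.re_ofReal_mul]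
  rw [this]
  exact (tendsto_pow_atTop_atTop_of_one_lt one_lt_two).atTop_mul_const hx

theorem two_pow_mul_re_pos {x : ℂ} (hx : 0 < x.re) (n : ℕ) : 0 < ((2 : ℂ) ^ n * x).re := by
  have : ((2 : ℂ) ^ n) = ((2 ^ n : ℝ) : ℂ) := by push_cast; rfl
  rw [this, Complex.re_ofReal_mul]
  positivity

/-- A zero would propagate along 2ⁿx, contradicting the nonzero limit. -/
theorem ne_zero_of_tendsto_of_two_mul {g : ℂ → ℂ} {a : ℂ} (ha : a ≠ 0)
    (h : Tendsto g reAtTop (𝓝 a)) (hg : ∀ x : ℂ, 0 < x.re → g x = 0 → g (2 * x) = 0)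
    {x : ℂ} (hx : 0 < x.re) : g x ≠ 0 := by
  intro h0
  have hn : ∀ n : ℕ, g (2 ^ n * x) = 0 := by
    intro n
    induction n with
    | zero => simpa using h0
    | succ n ih =>
      have := hg _ (two_pow_mul_re_pos hx n) ih
      rwa [← mul_assoc, ← pow_succ'] at this
  have := h.comp (tendsto_two_pow_mul_reAtTop hx)
  simp only [Function.comp_def, hn] at this
  exact ha (tendsto_nhds_unique this tendsto_const_nhds)

end Decay

/-! ### Theta constants have no zeros in the half-plane -/

section NonVanishing

variable {x : ℂ}

theorem theta4_ne_zero (hx : 0 < x.re) : theta4 x ≠ 0 := by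
  refine ne_zero_of_tendsto_of_two_mul one_ne_zero
    (by simpa using expDecay_theta4_sub_one.tendsto.add_const 1) (fun y hy h => ?_) hx
  have := theta3_mul_theta4 hy
  rw [h, mul_zero] at this
  exact pow_eq_zero_iff two_ne_zero |>.1 this.symm

theorem theta3_ne_zero (hx : 0 < x.re) : theta3 x ≠ 0 := by
  intro h
  have := theta3_mul_theta4 hx
  rw [h, zero_mul] at this
  exact theta4_ne_zero (x := 2 * x) (by simpa using hx) (pow_eq_zero_iff two_ne_zero |>.1 this.symm)

theorem theta2_ne_zero (hx : 0 < x.re) : theta2 x ≠ 0 := by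
  have := ne_zero_of_tendsto_of_two_mul (g := fun x =>
    Complex.exp ((Real.pi / 4 : ℝ) * x) * theta2 x) two_ne_zero
    (by simpa using expDecay_exp_mul_theta2_sub.tendsto.add_const 2) (fun y hy h => ?_) hx
  · exact right_ne_zero_of_mul this
  · have h1 := (mul_eq_zero.1 h).resolve_left (Complex.exp_ne_zero _)
    have h2 := theta2_sq_eq hy
    rw [h1] at h2
    have h3 := theta3_ne_zero (x := 2 * y) (by simpa using hy)
    have : theta2 (2 * y) = 0 := by
      by_contra h4
      exact mul_ne_zero (mul_ne_zero two_ne_zero h4) h3 (by rw [← h2]; ring)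
    simp only [this, mul_zero]

theorem expDecay_logDeriv_theta3 : ExpDecay (logDeriv theta3) :=
  expDecay_theta3_sub_one.logDeriv one_ne_zero fun _ => differentiableAt_theta3

theorem expDecay_logDeriv_theta4 : ExpDecay (logDeriv theta4) :=
  expDecay_theta4_sub_one.logDeriv one_ne_zero fun _ => differentiableAt_theta4

theorem expDecay_logDeriv_theta2_add : ExpDecay fun x => logDeriv theta2 x + Real.pi / 4 := by
  have hde : ∀ x : ℂ, HasDerivAt (fun x : ℂ => Complex.exp ((Real.pi / 4 : ℝ) * x))
      (Complex.exp ((Real.pi / 4 : ℝ) * x) * ((Real.pi / 4 : ℝ) * 1)) x := fun x =>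
    ((hasDerivAt_id x).const_mul ((Real.pi / 4 : ℝ) : ℂ)).cexp
  have h := expDecay_exp_mul_theta2_sub.logDeriv two_ne_zero fun x hx =>
    (hde x).differentiableAt.mul (differentiableAt_theta2 hx)
  refine h.congr' ?_ EventuallyEq.rfl
  filter_upwards [eventually_reAtTop_lt 0] with x hx
  rw [logDeriv_mul (f := fun x : ℂ => Complex.exp ((Real.pi / 4 : ℝ) * x)) x
    (Complex.exp_ne_zero _) (theta2_ne_zero hx) (hde x).differentiableAt
    (differentiableAt_theta2 hx), logDeriv_apply, (hde x).deriv,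
    mul_div_cancel_left₀ _ (Complex.exp_ne_zero _)]
  push_cast
  ring

end NonVanishing

theorem hasDerivAt_mul_logDeriv {g : ℂ → ℂ} {x : ℂ} (hg : DifferentiableAt ℂ g x)
    (h0 : g x ≠ 0) : HasDerivAt g (g x * logDeriv g x) x := by
  rw [logDeriv_apply, mul_div_cancel₀ _ h0]
  exact hg.hasDerivAt

theorem HasDerivAt.comp_two_mul {g : ℂ → ℂ} {g' x : ℂ} (hg : HasDerivAt g g' (2 * x)) :
    HasDerivAt (fun y => g (2 * y)) (g' * 2) x := by
  have : HasDerivAt (fun y : ℂ => 2 * y) (2 * 1) x := (hasDerivAt_id x).const_mul 2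
  rw [mul_one] at this
  exact HasDerivAt.comp x hg this

theorem eq_of_hasDerivAt_of_eq_re_pos {g h : ℂ → ℂ} {g' h' x : ℂ} (hx : 0 < x.re)
    (hgh : ∀ y : ℂ, 0 < y.re → g y = h y) (hg : HasDerivAt g g' x) (hh : HasDerivAt h h' x) :
    g' = h' := by
  refine hg.unique (hh.congr_of_eventuallyEq ?_)
  filter_upwards [(isOpen_lt continuous_const Complex.continuous_re).mem_nhds hx] with y hy
  exact hgh y hy

/-! ### Differences of logarithmic derivatives -/

section LogDeriv

variable {x : ℂ}

theorem two_mul_re_pos (hx : 0 < x.re) : 0 < (2 * x).re := by simpa using hx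

theorem hasDerivAt_theta2 (hx : 0 < x.re) : HasDerivAt theta2 (theta2 x * logDeriv theta2 x) x :=
  hasDerivAt_mul_logDeriv (differentiableAt_theta2 hx) (theta2_ne_zero hx)

theorem hasDerivAt_theta3 (hx : 0 < x.re) : HasDerivAt theta3 (theta3 x * logDeriv theta3 x) x :=
  hasDerivAt_mul_logDeriv (differentiableAt_theta3 hx) (theta3_ne_zero hx)

theorem hasDerivAt_theta4 (hx : 0 < x.re) : HasDerivAt theta4 (theta4 x * logDeriv theta4 x) x :=
  hasDerivAt_mul_logDeriv (differentiableAt_theta4 hx) (theta4_ne_zero hx)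

theorem logDeriv_theta_sq_add (hx : 0 < x.re) :
    theta3 x ^ 2 * logDeriv theta3 x + theta4 x ^ 2 * logDeriv theta4 x =
      4 * theta3 (2 * x) ^ 2 * logDeriv theta3 (2 * x) := by
  have := eq_of_hasDerivAt_of_eq_re_pos hx (fun y hy => theta3_sq_add_theta4_sq hy)
    (((hasDerivAt_theta3 hx).fun_pow 2).add ((hasDerivAt_theta4 hx).fun_pow 2))
    (((hasDerivAt_theta3 (two_mul_re_pos hx)).comp_two_mul.fun_pow 2).const_mul 2)
  norm_num at this
  linear_combination this / 2

theorem logDeriv_theta_sq_sub (hx : 0 < x.re) :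
    theta3 x ^ 2 * logDeriv theta3 x - theta4 x ^ 2 * logDeriv theta4 x =
      4 * theta2 (2 * x) ^ 2 * logDeriv theta2 (2 * x) := by
  have := eq_of_hasDerivAt_of_eq_re_pos hx
    (fun y hy => show theta3 y ^ 2 - theta4 y ^ 2 = 2 * theta2 (2 * y) ^ 2 by
      linear_combination theta3_sq_eq hy - theta4_sq_eq hy)
    (((hasDerivAt_theta3 hx).fun_pow 2).sub ((hasDerivAt_theta4 hx).fun_pow 2))
    (((hasDerivAt_theta2 (two_mul_re_pos hx)).comp_two_mul.fun_pow 2).const_mul 2)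
  norm_num at this
  linear_combination this / 2

theorem logDeriv_theta3_add_theta4 (hx : 0 < x.re) :
    logDeriv theta3 x + logDeriv theta4 x = 4 * logDeriv theta4 (2 * x) := by
  have := eq_of_hasDerivAt_of_eq_re_pos hx (fun y hy => theta3_mul_theta4 hy)
    ((hasDerivAt_theta3 hx).mul (hasDerivAt_theta4 hx))
    ((hasDerivAt_theta4 (two_mul_re_pos hx)).comp_two_mul.fun_pow 2)
  norm_num at this
  refine mul_left_cancel₀ (mul_ne_zero (theta3_ne_zero hx) (theta4_ne_zero hx)) ?_
  linear_combination this - 4 * logDeriv theta4 (2 * x) * theta3_mul_theta4 hx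

theorem theta2_pow_four_eq (hx : 0 < x.re) :
    theta2 x ^ 4 = 4 * theta2 (2 * x) ^ 2 * theta3 (2 * x) ^ 2 := by
  linear_combination (theta2 x ^ 2 + 2 * theta2 (2 * x) * theta3 (2 * x)) * theta2_sq_eq hx

theorem logDeriv_theta3_sub_theta4_two_mul (hx : 0 < x.re) :
    (logDeriv theta3 (2 * x) - logDeriv theta4 (2 * x)) / theta2 (2 * x) ^ 4 =
      (logDeriv theta3 x - logDeriv theta4 x) / theta2 x ^ 4 := by
  rw [div_eq_div_iff (pow_ne_zero 4 (theta2_ne_zero (two_mul_re_pos hx)))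
    (pow_ne_zero 4 (theta2_ne_zero hx)), theta2_pow_four_eq hx]
  have h1 := logDeriv_theta_sq_add hx
  rw [theta3_sq_eq hx, theta4_sq_eq hx] at h1
  linear_combination theta2 (2 * x) ^ 2 * (theta3 (2 * x) ^ 2 * logDeriv_theta3_add_theta4 hx - h1)

theorem logDeriv_theta2_sub_theta3_two_mul (hx : 0 < x.re) :
    (logDeriv theta2 (2 * x) - logDeriv theta3 (2 * x)) / theta4 (2 * x) ^ 4 =
      (logDeriv theta3 x - logDeriv theta4 x) / theta2 x ^ 4 := by
  rw [div_eq_div_iff (pow_ne_zero 4 (theta4_ne_zero (two_mul_re_pos hx)))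
    (pow_ne_zero 4 (theta2_ne_zero hx)), theta2_pow_four_eq hx]
  have h1 := logDeriv_theta_sq_add hx
  have h2 := logDeriv_theta_sq_sub hx
  have h3 : theta4 (2 * x) ^ 4 = theta3 x ^ 2 * theta4 x ^ 2 := by
    rw [← mul_pow, theta3_mul_theta4 hx]
    ring
  rw [h3]
  rw [theta3_sq_eq hx, theta4_sq_eq hx] at h1 h2 ⊢
  linear_combination theta2 (2 * x) ^ 2 * h1 - theta3 (2 * x) ^ 2 * h2

/-- The quotient by θ₂⁴ is invariant under doubling, but both its terms vanish at infinity. It is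
therefore traded for the equal quotient (`logDeriv theta2` − `logDeriv theta3`)/θ₄⁴, whose limit
−π/4 is visible. -/
theorem logDeriv_theta3_sub_theta4 (hx : 0 < x.re) :
    logDeriv theta3 x - logDeriv theta4 x = -(Real.pi / 4) * theta2 x ^ 4 := by
  rw [← div_eq_iff (pow_ne_zero 4 (theta2_ne_zero hx))]
  have hn : ∀ n : ℕ, (logDeriv theta2 (2 * (2 ^ n * x)) - logDeriv theta3 (2 * (2 ^ n * x))) /
      theta4 (2 * (2 ^ n * x)) ^ 4 = (logDeriv theta3 x - logDeriv theta4 x) / theta2 x ^ 4 := by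
    intro n
    rw [logDeriv_theta2_sub_theta3_two_mul (two_pow_mul_re_pos hx n)]
    induction n with
    | zero => simp
    | succ n ih =>
      rw [pow_succ', mul_assoc, logDeriv_theta3_sub_theta4_two_mul (two_pow_mul_re_pos hx n), ih]
  have hl : Tendsto (fun y => (logDeriv theta2 y - logDeriv theta3 y) / theta4 y ^ 4) reAtTop
      (𝓝 (-(Real.pi / 4))) := by
    have h2 : Tendsto (logDeriv theta2) reAtTop (𝓝 (-(Real.pi / 4))) := by
      simpa using expDecay_logDeriv_theta2_add.tendsto.sub_const ((Real.pi : ℂ) / 4)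
    have h4 : Tendsto theta4 reAtTop (𝓝 1) := by
      simpa using expDecay_theta4_sub_one.tendsto.add_const 1
    have := (h2.sub expDecay_logDeriv_theta3.tendsto).div (h4.pow 4) (by simp)
    rw [one_pow, div_one, sub_zero] at this
    exact this
  have hc := hl.comp (tendsto_two_pow_mul_reAtTop (two_mul_re_pos hx))
  refine tendsto_nhds_unique (tendsto_const_nhds (f := atTop (α := ℕ))) (hc.congr fun n => ?_)
  rw [← hn n, Function.comp, mul_left_comm]

theorem logDeriv_theta2_sub_theta3 (hx : 0 < x.re) :
    logDeriv theta2 x - logDeriv theta3 x = -(Real.pi / 4) * theta4 x ^ 4 := by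
  have h2 : 0 < (x / 2).re := by simpa using hx
  have h := logDeriv_theta2_sub_theta3_two_mul h2
  rw [mul_div_cancel₀ x two_ne_zero, logDeriv_theta3_sub_theta4 h2,
    mul_div_cancel_right₀ _ (pow_ne_zero 4 (theta2_ne_zero h2)),
    div_eq_iff (pow_ne_zero 4 (theta4_ne_zero hx))] at h
  exact h

theorem logDeriv_theta2_sub_theta4 (hx : 0 < x.re) :
    logDeriv theta2 x - logDeriv theta4 x = -(Real.pi / 4) * theta3 x ^ 4 := by
  linear_combination logDeriv_theta2_sub_theta3 hx + logDeriv_theta3_sub_theta4 hx +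
    (Real.pi / 4) * theta3_pow_four_sub hx

end LogDeriv

/-! ### The Darboux–Halphen system -/

section Halphen

variable {x : ℂ}

theorem differentiableAt_logDeriv_of_re_pos {g : ℂ → ℂ}
    (hd : ∀ x : ℂ, 0 < x.re → DifferentiableAt ℂ g x) (h0 : ∀ x : ℂ, 0 < x.re → g x ≠ 0)
    (hx : 0 < x.re) : DifferentiableAt ℂ (logDeriv g) x := by
  have ho : IsOpen {y : ℂ | 0 < y.re} := isOpen_lt continuous_const Complex.continuous_re
  have hD : DifferentiableOn ℂ g {y : ℂ | 0 < y.re} := fun y hy =>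
    (hd y hy).differentiableWithinAt
  exact ((hD.deriv ho).differentiableAt (ho.mem_nhds hx)).div (hd x hx) (h0 x hx)

theorem hasDerivAt_logDeriv_theta2_deriv (hx : 0 < x.re) :
    HasDerivAt (logDeriv theta2) (deriv (logDeriv theta2) x) x :=
  (differentiableAt_logDeriv_of_re_pos (fun _ => differentiableAt_theta2)
    (fun _ => theta2_ne_zero) hx).hasDerivAt

theorem hasDerivAt_logDeriv_theta3_deriv (hx : 0 < x.re) :
    HasDerivAt (logDeriv theta3) (deriv (logDeriv theta3) x) x :=
  (differentiableAt_logDeriv_of_re_pos (fun _ => differentiableAt_theta3)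
    (fun _ => theta3_ne_zero) hx).hasDerivAt

theorem hasDerivAt_logDeriv_theta4_deriv (hx : 0 < x.re) :
    HasDerivAt (logDeriv theta4) (deriv (logDeriv theta4) x) x :=
  (differentiableAt_logDeriv_of_re_pos (fun _ => differentiableAt_theta4)
    (fun _ => theta4_ne_zero) hx).hasDerivAt

/-- This and the next lemma differentiate Jacobi's formulas. They give the differences of the
Halphen equations, so only one equation remains to be proved. -/
theorem deriv_logDeriv_theta2_sub (hx : 0 < x.re) :
    deriv (logDeriv theta2) x - deriv (logDeriv theta3) x =
      4 * logDeriv theta4 x * (logDeriv theta2 x - logDeriv theta3 x) := by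
  have := eq_of_hasDerivAt_of_eq_re_pos hx (fun y hy => logDeriv_theta2_sub_theta3 hy)
    ((hasDerivAt_logDeriv_theta2_deriv hx).sub (hasDerivAt_logDeriv_theta3_deriv hx))
    (((hasDerivAt_theta4 hx).fun_pow 4).const_mul (-(Real.pi / 4) : ℂ))
  norm_num at this
  rw [this, logDeriv_theta2_sub_theta3 hx]
  ring

theorem deriv_logDeriv_theta3_sub (hx : 0 < x.re) :
    deriv (logDeriv theta3) x - deriv (logDeriv theta4) x =
      4 * logDeriv theta2 x * (logDeriv theta3 x - logDeriv theta4 x) := by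
  have := eq_of_hasDerivAt_of_eq_re_pos hx (fun y hy => logDeriv_theta3_sub_theta4 hy)
    ((hasDerivAt_logDeriv_theta3_deriv hx).sub (hasDerivAt_logDeriv_theta4_deriv hx))
    (((hasDerivAt_theta2 hx).fun_pow 4).const_mul (-(Real.pi / 4) : ℂ))
  norm_num at this
  rw [this, logDeriv_theta3_sub_theta4 hx]
  ring

theorem deriv_logDeriv_theta3_add (hx : 0 < x.re) :
    deriv (logDeriv theta3) x + deriv (logDeriv theta4) x =
      8 * deriv (logDeriv theta4) (2 * x) := by
  have := eq_of_hasDerivAt_of_eq_re_pos hx (fun y hy => logDeriv_theta3_add_theta4 hy)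
    ((hasDerivAt_logDeriv_theta3_deriv hx).add (hasDerivAt_logDeriv_theta4_deriv hx))
    ((hasDerivAt_logDeriv_theta4_deriv (two_mul_re_pos hx)).comp_two_mul.const_mul 4)
  rw [this]
  ring

/-- The defect in the Halphen equation for the logarithmic derivative of `θ₃`. -/
noncomputable def halphenDefect (x : ℂ) : ℂ :=
  deriv (logDeriv theta3) x - 2 * (logDeriv theta3 x * logDeriv theta2 x +
    logDeriv theta3 x * logDeriv theta4 x - logDeriv theta2 x * logDeriv theta4 x)

theorem halphenDefect_two_mul (hx : 0 < x.re) : halphenDefect x = 4 * halphenDefect (2 * x) := by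
  have h2 := two_mul_re_pos hx
  -- The one input that is not a differentiated duplication formula: θ₂⁸(x) = 16θ₂⁴θ₃⁴(2x), read
  -- through the closed forms of the differences.
  have e4 : (logDeriv theta3 x - logDeriv theta4 x) ^ 2 = 16 *
      (logDeriv theta3 (2 * x) - logDeriv theta4 (2 * x)) *
      (logDeriv theta2 (2 * x) - logDeriv theta4 (2 * x)) := by
    rw [logDeriv_theta3_sub_theta4 hx, logDeriv_theta3_sub_theta4 h2,
      logDeriv_theta2_sub_theta4 h2, theta2_pow_four_eq hx]
    ring
  have e3 := logDeriv_theta3_add_theta4 hx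
  rw [halphenDefect, halphenDefect]
  linear_combination (deriv_logDeriv_theta3_add hx) / 2 + (deriv_logDeriv_theta3_sub hx) / 2 -
    4 * deriv_logDeriv_theta3_sub h2 + e4 / 2 - (logDeriv theta3 x + logDeriv theta4 x +
      4 * logDeriv theta4 (2 * x)) / 2 * e3

theorem ExpDecay.mul_tendsto {f g : ℂ → ℂ} {a : ℂ} (hf : ExpDecay f)
    (hg : Tendsto g reAtTop (𝓝 a)) : ExpDecay fun x => f x * g x := by
  have := IsBigO.mul hf (hg.isBigO_one ℝ)
  simpa only [mul_one] using this

theorem expDecay_halphenDefect : ExpDecay halphenDefect := by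
  have h2 : Tendsto (logDeriv theta2) reAtTop (𝓝 (-(Real.pi / 4))) := by
    simpa using expDecay_logDeriv_theta2_add.tendsto.sub_const ((Real.pi : ℂ) / 4)
  have h4 := expDecay_logDeriv_theta4
  have h3 := expDecay_logDeriv_theta3
  have hd : ExpDecay (deriv (logDeriv theta3)) := h3.deriv fun x hx =>
    (hasDerivAt_logDeriv_theta3_deriv hx).differentiableAt
  exact (hd.sub ((((h3.mul_tendsto h2).add (h3.mul_tendsto h4.tendsto)).sub
    (h4.mul_tendsto h2)).const_mul_left 2)).congr_left fun x => by
      rw [halphenDefect, mul_comm (logDeriv theta4 x) (logDeriv theta2 x)]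

/-- The product (Re x)² · `halphenDefect x` is invariant under doubling, while exponential decay
beats the quadratic factor. -/
theorem halphenDefect_eq_zero (hx : 0 < x.re) : halphenDefect x = 0 := by
  have hn : ∀ n : ℕ, halphenDefect x = 4 ^ n * halphenDefect (2 ^ n * x) := by
    intro n
    induction n with
    | zero => simp
    | succ n ih =>
      rw [ih, halphenDefect_two_mul (two_pow_mul_re_pos hx n), pow_succ 4 n, pow_succ' 2 n,
        mul_assoc, mul_assoc 2]
  have h1 : Tendsto (fun y : ℂ => ((y.re ^ 2 : ℝ) : ℂ) * halphenDefect y) reAtTop (𝓝 0) := by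
    have h := (isBigO_refl (fun y : ℂ => ((y.re ^ 2 : ℝ) : ℂ)) reAtTop).norm_right.mul
      expDecay_halphenDefect
    refine h.trans_tendsto ?_
    have := (Real.tendsto_pow_mul_exp_neg_atTop_nhds_zero 2).comp
      (tendsto_comap (f := Complex.re) (x := atTop))
    refine this.congr fun y => ?_
    simp only [Function.comp, Complex.norm_real, norm_pow, Real.norm_eq_abs, sq_abs, neg_one_mul]
  have h2 := h1.comp (tendsto_two_pow_mul_reAtTop hx)
  have h3 : ((x.re ^ 2 : ℝ) : ℂ) * halphenDefect x = 0 := by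
    refine tendsto_nhds_unique (tendsto_const_nhds (f := atTop (α := ℕ))) (h2.congr fun n => ?_)
    have : ((2 : ℂ) ^ n) = ((2 ^ n : ℝ) : ℂ) := by push_cast; rfl
    have e : ((2 : ℂ) ^ n * x).re = 2 ^ n * x.re := by rw [this, Complex.re_ofReal_mul]
    have e4 : (4 : ℂ) ^ n = 2 ^ n * 2 ^ n := by rw [← mul_pow]; norm_num
    simp only [Function.comp]
    rw [hn n, e, e4]
    push_cast
    ring
  refine (mul_eq_zero.1 h3).resolve_left ?_
  exact Complex.ofReal_ne_zero.2 (by positivity)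

/-- The Darboux–Halphen system, with the normalisation of logarithmic derivatives of theta
constants. -/
structure IsHalphenAt (f g h : ℂ → ℂ) (x : ℂ) : Prop where
  left : HasDerivAt f (2 * (f x * g x + f x * h x - g x * h x)) x
  mid : HasDerivAt g (2 * (g x * f x + g x * h x - f x * h x)) x
  right : HasDerivAt h (2 * (h x * f x + h x * g x - f x * g x)) x

theorem isHalphenAt_theta (hx : 0 < x.re) :
    IsHalphenAt (logDeriv theta2) (logDeriv theta3) (logDeriv theta4) x := by
  have h := halphenDefect_eq_zero hx
  rw [halphenDefect] at h
  refine ⟨?_, ?_, ?_⟩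
  · convert hasDerivAt_logDeriv_theta2_deriv hx using 1
    linear_combination -h - deriv_logDeriv_theta2_sub hx
  · convert hasDerivAt_logDeriv_theta3_deriv hx using 1
    linear_combination -h
  · convert hasDerivAt_logDeriv_theta4_deriv hx using 1
    linear_combination -h + deriv_logDeriv_theta3_sub hx

end Halphen

/-! ### Gauss's elliptic integral and the lemniscatic value -/

/-- The complete elliptic integral of the first kind in Gauss's symmetric form. -/
noncomputable def gaussIntegral (a b : ℝ) : ℝ :=
  ∫ t in Ioi (0 : ℝ), (√((t ^ 2 + a ^ 2) * (t ^ 2 + b ^ 2)))⁻¹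

theorem gaussIntegral_eq_integral_univ (a b : ℝ) :
    ∫ t : ℝ, (√((t ^ 2 + a ^ 2) * (t ^ 2 + b ^ 2)))⁻¹ = 2 * gaussIntegral a b := by
  rw [gaussIntegral, ← integral_comp_abs]
  simp only [sq_abs]

theorem image_gauss_substitution {c : ℝ} (hc : 0 < c) :
    (fun t : ℝ => (t - c / t) / 2) '' Ioi 0 = univ := by
  refine eq_univ_of_forall fun u => ?_
  have hs : √(u ^ 2 + c) ^ 2 = u ^ 2 + c := Real.sq_sqrt (by positivity)
  have hu : 0 < u + √(u ^ 2 + c) := by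
    have : |u| < √(u ^ 2 + c) := by
      rw [← Real.sqrt_sq_eq_abs]
      exact Real.sqrt_lt_sqrt (sq_nonneg u) (by linarith)
    linarith [neg_abs_le u]
  refine ⟨u + √(u ^ 2 + c), hu, ?_⟩
  have := hu.ne'
  field_simp
  linear_combination hs

theorem injOn_gauss_substitution {c : ℝ} (hc : 0 < c) :
    InjOn (fun t : ℝ => (t - c / t) / 2) (Ioi 0) := by
  intro s hs t ht h
  have hs : 0 < s := hs
  have ht : 0 < t := ht
  have hs0 := hs.ne'
  have ht0 := ht.ne'
  simp only at h
  field_simp at h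
  have h2 : (s - t) * (s * t + c) = 0 := by linear_combination h
  have h3 : s * t + c ≠ 0 := by positivity
  linarith [(mul_eq_zero.1 h2).resolve_right h3]

/-- Gauss's invariance of the elliptic integral under the arithmetic-geometric step. -/
theorem gaussIntegral_agm {a b : ℝ} (ha : 0 < a) (hb : 0 < b) :
    gaussIntegral ((a + b) / 2) (√(a * b)) = gaussIntegral a b := by
  have hc : 0 < a * b := mul_pos ha hb
  have hd : ∀ t ∈ Ioi (0 : ℝ), HasDerivWithinAt (fun t : ℝ => (t - a * b / t) / 2)
      ((1 + a * b / t ^ 2) / 2) (Ioi 0) t := by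
    intro t ht
    have ht0 : t ≠ 0 := (mem_Ioi.1 ht).ne'
    have h := ((hasDerivAt_id t).sub ((hasDerivAt_inv ht0).const_mul (a * b))).div_const 2
    refine (h.congr_deriv ?_).hasDerivWithinAt
    field_simp
    ring
  have h := integral_image_eq_integral_abs_deriv_smul measurableSet_Ioi hd
    (injOn_gauss_substitution hc)
    (fun u : ℝ => (√((u ^ 2 + ((a + b) / 2) ^ 2) * (u ^ 2 + √(a * b) ^ 2)))⁻¹)
  rw [image_gauss_substitution hc, setIntegral_univ, gaussIntegral_eq_integral_univ] at h
  have h2 : ∫ t in Ioi (0 : ℝ), |(1 + a * b / t ^ 2) / 2| •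
      (√((((t - a * b / t) / 2) ^ 2 + ((a + b) / 2) ^ 2) *
        (((t - a * b / t) / 2) ^ 2 + √(a * b) ^ 2)))⁻¹ = 2 * gaussIntegral a b := by
    rw [gaussIntegral, ← integral_const_mul]
    refine setIntegral_congr_fun measurableSet_Ioi fun t ht => ?_
    have ht : 0 < t := ht
    have ht0 := ht.ne'
    rw [Real.sq_sqrt hc.le, abs_of_pos (by positivity), smul_eq_mul]
    -- With u = (t − ab/t)/2 one has u² + ab = (t + ab/t)²/4 and u² + ((a+b)/2)² =
    -- (t²+a²)(t²+b²)/(4t²).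
    have e : (((t - a * b / t) / 2) ^ 2 + ((a + b) / 2) ^ 2) *
        (((t - a * b / t) / 2) ^ 2 + a * b) =
        ((1 + a * b / t ^ 2) / 4) ^ 2 * ((t ^ 2 + a ^ 2) * (t ^ 2 + b ^ 2)) := by
      field_simp
      ring
    have hp : 0 < (1 + a * b / t ^ 2) / 4 := by positivity
    rw [e, Real.sqrt_mul (sq_nonneg _), Real.sqrt_sq hp.le, mul_inv, ← mul_assoc]
    congr 1
    field_simp
    norm_num
  linarith

theorem gaussIntegral_one_one : gaussIntegral 1 1 = Real.pi / 2 := by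
  have h : ∀ t : ℝ, (√((t ^ 2 + 1 ^ 2) * (t ^ 2 + 1 ^ 2)))⁻¹ = (1 + t ^ 2)⁻¹ := by
    intro t
    rw [Real.sqrt_mul_self (by positivity), one_pow, add_comm]
  rw [gaussIntegral]
  simp only [h, integral_Ioi_inv_one_add_sq, Real.arctan_zero, sub_zero]

theorem tendsto_gaussIntegral {a b : ℕ → ℝ} (ha : Tendsto a atTop (𝓝 1))
    (hb : Tendsto b atTop (𝓝 1)) :
    Tendsto (fun n => gaussIntegral (a n) (b n)) atTop (𝓝 (gaussIntegral 1 1)) := by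
  have hpos : ∀ t : ℝ, √((t ^ 2 + 1 ^ 2) * (t ^ 2 + 1 ^ 2)) ≠ 0 := fun t =>
    (Real.sqrt_pos.2 (by positivity)).ne'
  refine tendsto_integral_filter_of_dominated_convergence (fun t : ℝ => 4 * (1 + t ^ 2)⁻¹)
    (Eventually.of_forall fun n => ?_) ?_ ?_ (Eventually.of_forall fun t => ?_)
  · exact Measurable.aestronglyMeasurable (by fun_prop)
  · filter_upwards [ha.eventually (lt_mem_nhds (show (1 / 2 : ℝ) < 1 by norm_num)),
      hb.eventually (lt_mem_nhds (show (1 / 2 : ℝ) < 1 by norm_num))] with n h1 h2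
    refine Eventually.of_forall fun t => ?_
    have e1 : (1 + t ^ 2) / 4 ≤ t ^ 2 + a n ^ 2 := by nlinarith [sq_nonneg t]
    have e2 : (1 + t ^ 2) / 4 ≤ t ^ 2 + b n ^ 2 := by nlinarith [sq_nonneg t]
    have hp : 0 < (1 + t ^ 2) / 4 := by positivity
    have e3 : (1 + t ^ 2) / 4 ≤ √((t ^ 2 + a n ^ 2) * (t ^ 2 + b n ^ 2)) := by
      refine Real.le_sqrt_of_sq_le ?_
      rw [sq]
      exact mul_le_mul e1 e2 hp.le (by positivity)
    rw [Real.norm_eq_abs, abs_of_nonneg (by positivity)]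
    refine (inv_anti₀ hp e3).trans_eq ?_
    rw [inv_div, div_eq_mul_inv]
  · exact (integrable_inv_one_add_sq.const_mul 4).integrableOn
  · refine Tendsto.inv₀ ?_ (hpos t)
    exact (((ha.pow 2).const_add (t ^ 2)).mul ((hb.pow 2).const_add (t ^ 2))).sqrt

theorem gaussIntegral_mul {a b c : ℝ} (hc : 0 < c) :
    gaussIntegral (c * a) (c * b) = c⁻¹ * gaussIntegral a b := by
  have h := integral_comp_mul_left_Ioi
    (fun t : ℝ => (√((t ^ 2 + (c * a) ^ 2) * (t ^ 2 + (c * b) ^ 2)))⁻¹) 0 hc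
  rw [mul_zero, smul_eq_mul] at h
  have h2 : ∀ t : ℝ, (√(((c * t) ^ 2 + (c * a) ^ 2) * ((c * t) ^ 2 + (c * b) ^ 2)))⁻¹ =
      (c ^ 2)⁻¹ * (√((t ^ 2 + a ^ 2) * (t ^ 2 + b ^ 2)))⁻¹ := by
    intro t
    have : ((c * t) ^ 2 + (c * a) ^ 2) * ((c * t) ^ 2 + (c * b) ^ 2) =
      (c ^ 2) ^ 2 * ((t ^ 2 + a ^ 2) * (t ^ 2 + b ^ 2)) := by ring
    rw [this, Real.sqrt_mul (sq_nonneg _), Real.sqrt_sq (sq_nonneg c), mul_inv]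
  simp only [h2, integral_const_mul] at h
  rw [gaussIntegral, gaussIntegral]
  have hc0 := hc.ne'
  field_simp at h ⊢
  linear_combination -h

theorem integral_rpow_mul_one_sub_rpow {u v : ℝ} (hu : 0 < u) (hv : 0 < v) :
    ∫ w in Ioo (0 : ℝ) 1, w ^ (u - 1) * (1 - w) ^ (v - 1) =
      Real.Gamma u * Real.Gamma v / Real.Gamma (u + v) := by
  have h := Complex.betaIntegral_eq_Gamma_mul_div u v (by simpa) (by simpa)
  rw [Complex.betaIntegral, intervalIntegral.integral_of_le zero_le_one,
    integral_Ioc_eq_integral_Ioo] at h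
  have h2 : ∫ w in Ioo (0 : ℝ) 1, (w : ℂ) ^ ((u : ℂ) - 1) * (1 - (w : ℂ)) ^ ((v : ℂ) - 1) =
      ∫ w in Ioo (0 : ℝ) 1, ((w ^ (u - 1) * (1 - w) ^ (v - 1) : ℝ) : ℂ) := by
    refine setIntegral_congr_fun measurableSet_Ioo fun w hw => ?_
    rw [Complex.ofReal_mul, Complex.ofReal_cpow hw.1.le, Complex.ofReal_cpow (by linarith [hw.2])]
    push_cast
    rfl
  rw [h2, integral_complex_ofReal, ← Complex.ofReal_add, Complex.Gamma_ofReal,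
    Complex.Gamma_ofReal, Complex.Gamma_ofReal] at h
  exact_mod_cast h

/-- This is B(1/4, 1/2); the reflection formula eliminates Γ(3/4). -/
theorem integral_beta_quarter_half :
    ∫ w in Ioo (0 : ℝ) 1, w ^ (-(3 / 4) : ℝ) * (1 - w) ^ (-(1 / 2) : ℝ) =
      Real.Gamma (1 / 4) ^ 2 * √Real.pi / (Real.pi * √2) := by
  have h := integral_rpow_mul_one_sub_rpow (u := 1 / 4) (v := 1 / 2) (by norm_num) (by norm_num)
  rw [show (1 / 4 - 1 : ℝ) = -(3 / 4) by norm_num, show (1 / 2 - 1 : ℝ) = -(1 / 2) by norm_num,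
    show (1 / 4 + 1 / 2 : ℝ) = 3 / 4 by norm_num, Real.Gamma_one_half_eq] at h
  have hr := Real.Gamma_mul_Gamma_one_sub (1 / 4)
  rw [show Real.pi * (1 / 4) = Real.pi / 4 by ring, Real.sin_pi_div_four,
    show (1 - 1 / 4 : ℝ) = 3 / 4 by norm_num] at hr
  have h1 : 0 < Real.Gamma (1 / 4) := Real.Gamma_pos_of_pos (by norm_num)
  have h3 : 0 < Real.Gamma (3 / 4) := Real.Gamma_pos_of_pos (by norm_num)
  have hs2 : √2 ^ 2 = (2 : ℝ) := Real.sq_sqrt zero_le_two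
  have hs0 : √2 ≠ (0 : ℝ) := by positivity
  have hpi := Real.pi_pos
  rw [eq_div_iff (div_ne_zero hs0 two_ne_zero)] at hr
  have hr2 : Real.Gamma (1 / 4) * Real.Gamma (3 / 4) = Real.pi * √2 := by
    refine mul_right_cancel₀ hs0 ?_
    linear_combination 2 * hr - Real.pi * hs2
  rw [h, ← hr2]
  field_simp

theorem image_lemniscate_substitution :
    (fun t : ℝ => ((1 + t ^ 2) ^ 2)⁻¹) '' Ioi 0 = Ioo 0 1 := by
  ext w
  constructor
  · rintro ⟨t, ht, rfl⟩
    have ht : 0 < t := ht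
    refine ⟨by positivity, inv_lt_one_of_one_lt₀ ?_⟩
    nlinarith [sq_nonneg (t ^ 2), pow_pos ht 2]
  · rintro ⟨h0, h1⟩
    have hs0 : 0 < √w := Real.sqrt_pos.2 h0
    have hs1 : √w < 1 := by
      rw [Real.sqrt_lt' one_pos]
      simpa using h1
    have h2 : 0 < (√w)⁻¹ - 1 := by
      rw [sub_pos]
      exact (one_lt_inv₀ hs0).2 hs1
    refine ⟨√((√w)⁻¹ - 1), Real.sqrt_pos.2 h2, ?_⟩
    simp only
    rw [Real.sq_sqrt h2.le, add_sub_cancel, inv_pow, Real.sq_sqrt h0.le, inv_inv]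

/-- The substitution w = (1+t²)⁻² turns the Beta integral into 4 times this one. -/
theorem gaussIntegral_sqrt_two_one : gaussIntegral √2 1 =
    Real.Gamma (1 / 4) ^ 2 * √Real.pi / (Real.pi * √2) / 4 := by
  have hd : ∀ t ∈ Ioi (0 : ℝ), HasDerivWithinAt (fun t : ℝ => ((1 + t ^ 2) ^ 2)⁻¹)
      (-(4 * t / (1 + t ^ 2) ^ 3)) (Ioi 0) t := by
    intro t ht
    have hp : (1 + t ^ 2) ≠ 0 := by positivity
    have h := ((((hasDerivAt_id t).pow 2).const_add 1).pow 2).inv (pow_ne_zero 2 hp)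
    refine (h.congr_deriv ?_).hasDerivWithinAt
    simp only [id, Pi.pow_apply]
    field_simp
    norm_num
    ring
  have hinj : InjOn (fun t : ℝ => ((1 + t ^ 2) ^ 2)⁻¹) (Ioi 0) := by
    intro s hs t ht h
    have hs : 0 < s := hs
    have ht : 0 < t := ht
    have h1 := inv_injective h
    have h2 := (pow_left_inj₀ (by positivity) (by positivity) two_ne_zero).1 h1
    exact (pow_left_inj₀ hs.le ht.le two_ne_zero).1 (by linarith)
  have h := integral_image_eq_integral_abs_deriv_smul measurableSet_Ioi hd hinj
    (fun w : ℝ => w ^ (-(3 / 4) : ℝ) * (1 - w) ^ (-(1 / 2) : ℝ))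
  rw [image_lemniscate_substitution, integral_beta_quarter_half] at h
  rw [h, eq_div_iff four_ne_zero, mul_comm, gaussIntegral, ← integral_const_mul]
  refine setIntegral_congr_fun measurableSet_Ioi fun t ht => ?_
  have ht : 0 < t := ht
  have hp : 0 < 1 + t ^ 2 := by positivity
  rw [abs_neg, abs_of_pos (by positivity), smul_eq_mul]
  have e1 : (((1 + t ^ 2) ^ 2)⁻¹) ^ (-(3 / 4) : ℝ) = (1 + t ^ 2) * √(1 + t ^ 2) := by
    rw [← Real.rpow_natCast, ← Real.rpow_neg hp.le, ← Real.rpow_mul hp.le, Real.sqrt_eq_rpow,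
      ← Real.rpow_one_add' hp.le (by norm_num)]
    norm_num
  have e2 : (1 - ((1 + t ^ 2) ^ 2)⁻¹) ^ (-(1 / 2) : ℝ) = (1 + t ^ 2) / (t * √(t ^ 2 + 2)) := by
    have : 1 - ((1 + t ^ 2) ^ 2)⁻¹ = (t / (1 + t ^ 2)) ^ 2 * (t ^ 2 + 2) := by
      field_simp
      ring
    rw [this, Real.rpow_neg (by positivity), ← Real.sqrt_eq_rpow, Real.sqrt_mul (sq_nonneg _),
      Real.sqrt_sq (by positivity)]
    field_simp
  have e3 : (t ^ 2 + √2 ^ 2) * (t ^ 2 + 1 ^ 2) = (t ^ 2 + 2) * (1 + t ^ 2) := by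
    rw [Real.sq_sqrt zero_le_two]
    ring
  rw [e1, e2, e3, Real.sqrt_mul (by positivity)]
  have hs : √(1 + t ^ 2) ^ 2 = 1 + t ^ 2 := Real.sq_sqrt hp.le
  have hs0 : √(1 + t ^ 2) ≠ 0 := (Real.sqrt_pos.2 hp).ne'
  have hs1 : √(t ^ 2 + 2) ≠ 0 := (Real.sqrt_pos.2 (by positivity)).ne'
  field_simp
  linear_combination -hs

/-! ### The value of θ₃ at 1 -/

section ThetaValues

theorem ofReal_re_theta3 (x : ℝ) : ((theta3 x).re : ℂ) = theta3 x := by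
  rw [← Complex.conj_eq_iff_re, theta3, Complex.conj_tsum]
  refine tsum_congr fun n => ?_
  rw [← Complex.exp_conj]
  simp

theorem ofReal_re_theta4 (x : ℝ) : ((theta4 x).re : ℂ) = theta4 x := by
  have h := ofReal_re_theta3 (4 * x)
  push_cast at h
  rw [theta4, ← h, ← ofReal_re_theta3 x]
  simp

/-- θ₃(2x)² and θ₄(2x)² are the arithmetic and geometric means of θ₃(x)² and θ₄(x)². -/
theorem gaussIntegral_theta_two_mul {x : ℝ} (hx : 0 < x) :
    gaussIntegral ((theta3 ((2 * x : ℝ) : ℂ)).re ^ 2) ((theta4 ((2 * x : ℝ) : ℂ)).re ^ 2) =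
      gaussIntegral ((theta3 x).re ^ 2) ((theta4 x).re ^ 2) := by
  have hx' : 0 < (x : ℂ).re := by simpa using hx
  have h3 : (theta3 x).re ≠ 0 := fun h => theta3_ne_zero hx' (by
    rw [← ofReal_re_theta3, h, Complex.ofReal_zero])
  have h4 : (theta4 x).re ≠ 0 := fun h => theta4_ne_zero hx' (by
    rw [← ofReal_re_theta4, h, Complex.ofReal_zero])
  have e1 := theta3_sq_add_theta4_sq hx'
  have e2 := theta3_mul_theta4 hx'
  have ec : (2 : ℂ) * x = ((2 * x : ℝ) : ℂ) := by push_cast; rfl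
  rw [ec, ← ofReal_re_theta3, ← ofReal_re_theta4, ← ofReal_re_theta3 (2 * x)] at e1
  rw [ec, ← ofReal_re_theta3, ← ofReal_re_theta4, ← ofReal_re_theta4 (2 * x)] at e2
  norm_cast at e1 e2
  rw [← gaussIntegral_agm (a := (theta3 x).re ^ 2) (by positivity) (by positivity), ← mul_pow, e2,
    Real.sqrt_sq (sq_nonneg _), e1]
  congr 1
  ring

theorem gaussIntegral_theta {x : ℝ} (hx : 0 < x) :
    gaussIntegral ((theta3 x).re ^ 2) ((theta4 x).re ^ 2) = Real.pi / 2 := by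
  have hx' : 0 < (x : ℂ).re := by simpa using hx
  have hn : ∀ n : ℕ, gaussIntegral ((theta3 (2 ^ n * x)).re ^ 2) ((theta4 (2 ^ n * x)).re ^ 2) =
      gaussIntegral ((theta3 x).re ^ 2) ((theta4 x).re ^ 2) := by
    intro n
    induction n with
    | zero => simp
    | succ n ih =>
      have := gaussIntegral_theta_two_mul (x := 2 ^ n * x) (by positivity)
      push_cast at this
      rw [pow_succ' 2 n, mul_assoc, this, ih]
  have h3 : Tendsto theta3 reAtTop (𝓝 1) := by
    simpa using expDecay_theta3_sub_one.tendsto.add_const 1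
  have h4 : Tendsto theta4 reAtTop (𝓝 1) := by
    simpa using expDecay_theta4_sub_one.tendsto.add_const 1
  have hre : Tendsto (fun z : ℂ => z.re ^ 2) (𝓝 1) (𝓝 1) := by
    have : Continuous fun z : ℂ => z.re ^ 2 := by fun_prop
    simpa using this.tendsto 1
  have h := tendsto_gaussIntegral (hre.comp (h3.comp (tendsto_two_pow_mul_reAtTop hx')))
    (hre.comp (h4.comp (tendsto_two_pow_mul_reAtTop hx')))
  simp only [Function.comp_apply, hn] at h
  rw [← gaussIntegral_one_one]
  exact tendsto_nhds_unique tendsto_const_nhds h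

/-- x = 1 is fixed by inversion, which exchanges θ₂ and θ₄; concretely θ₃(1/4) = 2θ₃(4). -/
theorem theta2_one : theta2 1 = theta4 1 := by
  have h := theta3_inv (x := 4) (by norm_num)
  have h4 : (4 : ℂ) ^ (1 / 2 : ℂ) = 2 := by
    have e : (4 : ℝ) ^ (1 / 2 : ℝ) = 2 := by
      rw [← Real.sqrt_eq_rpow, show (4 : ℝ) = 2 ^ 2 by norm_num, Real.sqrt_sq zero_le_two]
    have := Complex.ofReal_cpow (x := 4) (by norm_num) (1 / 2)
    rw [e] at this
    push_cast at this
    exact this.symm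
  rw [h4] at h
  rw [theta2, theta4, one_div, h, mul_one]

theorem theta3_one_pow_eight :
    theta3 1 ^ 8 = ((Real.Gamma (1 / 4) ^ 8 / (16 * Real.pi ^ 6) : ℝ) : ℂ) := by
  have h1 : 0 < ((1 : ℝ) : ℂ).re := by simp
  have hG := gaussIntegral_theta one_pos
  have hq := theta3_pow_four_sub h1
  have h24 := theta2_one
  have e1 : ((1 : ℝ) : ℂ) = 1 := Complex.ofReal_one
  have h4 : (theta4 ((1 : ℝ) : ℂ)).re ≠ 0 := fun h => theta4_ne_zero h1 (by
    rw [← ofReal_re_theta4, h, Complex.ofReal_zero])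
  rw [← e1] at h24 ⊢
  rw [h24, ← ofReal_re_theta3, ← ofReal_re_theta4] at hq
  rw [← ofReal_re_theta3]
  set p := (theta3 ((1 : ℝ) : ℂ)).re
  set q := (theta4 ((1 : ℝ) : ℂ)).re
  norm_cast at hq ⊢
  -- Since θ₂(1) = θ₄(1), the quartic identity reads p⁴ = 2q⁴; homogeneity then reduces the integral
  -- to the arguments (√2, 1).
  have hpq : p ^ 2 = q ^ 2 * √2 := by
    refine (pow_left_inj₀ (sq_nonneg p) (by positivity) two_ne_zero).1 ?_
    rw [mul_pow, Real.sq_sqrt zero_le_two]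
    linarith
  have hq2 : 0 < q ^ 2 := by positivity
  have hI := gaussIntegral_mul (a := √2) (b := 1) hq2
  rw [mul_one, ← hpq, hG, gaussIntegral_sqrt_two_one] at hI
  have hpi := Real.pi_pos
  have hsp : √Real.pi ^ 2 = Real.pi := Real.sq_sqrt hpi.le
  have hs2 : √2 ^ 2 = (2 : ℝ) := Real.sq_sqrt zero_le_two
  have hs0 : √2 ≠ (0 : ℝ) := by positivity
  have hq3 : q ^ 2 * (2 * Real.pi ^ 2 * √2) = Real.Gamma (1 / 4) ^ 2 * √Real.pi := by
    field_simp at hI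
    linear_combination hI / 2
  have hq8 : q ^ 8 * (64 * Real.pi ^ 8) = Real.Gamma (1 / 4) ^ 8 * Real.pi ^ 2 := by
    calc q ^ 8 * (64 * Real.pi ^ 8) = q ^ 8 * 16 * Real.pi ^ 8 * (√2 ^ 2) ^ 2 := by
          rw [hs2]
          ring
      _ = (q ^ 2 * (2 * Real.pi ^ 2 * √2)) ^ 4 := by ring
      _ = Real.Gamma (1 / 4) ^ 8 * (√Real.pi ^ 2) ^ 2 := by
          rw [hq3]
          ring
      _ = _ := by rw [hsp]
  have hp8 : p ^ 8 = 4 * q ^ 8 := by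
    calc p ^ 8 = (p ^ 2) ^ 4 := by ring
      _ = q ^ 8 * (√2 ^ 2) ^ 2 := by
          rw [hpq]
          ring
      _ = _ := by
          rw [hs2]
          ring
  rw [hp8, eq_div_iff (by positivity)]
  refine mul_right_cancel₀ (pow_ne_zero 2 hpi.ne') ?_
  linear_combination hq8

end ThetaValues

/-! ### From the Halphen system to Jacobi's equation -/

section HalphenODE

variable {y f g h : ℂ → ℂ} {z : ℂ}

/-- Weight-two quasimodular covariance of the Halphen system. -/
theorem IsHalphenAt.comp {s s' μ : ℂ → ℂ} (H : IsHalphenAt f g h (s z))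
    (hs : HasDerivAt s (s' z) z) (hs' : HasDerivAt s' (4 * μ z * s' z) z)
    (hμ : HasDerivAt μ (2 * μ z ^ 2) z) :
    IsHalphenAt (fun w => s' w * f (s w) + μ w) (fun w => s' w * g (s w) + μ w)
      (fun w => s' w * h (s w) + μ w) z := by
  refine ⟨?_, ?_, ?_⟩
  · refine ((hs'.mul (H.left.comp z hs)).add hμ).congr_deriv ?_
    simp only [Function.comp]
    ring
  · refine ((hs'.mul (H.mid.comp z hs)).add hμ).congr_deriv ?_
    simp only [Function.comp]
    ring
  · refine ((hs'.mul (H.right.comp z hs)).add hμ).congr_deriv ?_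
    simp only [Function.comp]
    ring

/-- Jacobi's third-order equation follows from the Halphen system. -/
theorem jacobi_equation_of_isHalphenAt {U : Set ℂ} (hU : IsOpen U) {c : ℂ}
    (hy : ∀ w ∈ U, HasDerivAt y (y w * g w) w) (H : ∀ w ∈ U, IsHalphenAt f g h w)
    (hc : ∀ w ∈ U, (f w - h w) ^ 2 = c * y w ^ 8) (hz : z ∈ U) :
    (y z ^ 2 * iteratedDeriv 3 y z - 15 * y z * deriv y z * iteratedDeriv 2 y z
        + 30 * deriv y z ^ 3) ^ 2
      + 32 * (y z * iteratedDeriv 2 y z - 3 * deriv y z ^ 2) ^ 3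
    = 16 * c * y z ^ 10 * (y z * iteratedDeriv 2 y z - 3 * deriv y z ^ 2) ^ 2 := by
  have d1 : ∀ w ∈ U, deriv y w = y w * g w := fun w hw => (hy w hw).deriv
  have d2' : ∀ w ∈ U, HasDerivAt (deriv y)
      (y w * (g w ^ 2 + 2 * (g w * f w + g w * h w - f w * h w))) w := by
    intro w hw
    have := ((hy w hw).mul (H w hw).mid).congr_of_eventuallyEq
      (f₁ := deriv y) (eventually_of_mem (hU.mem_nhds hw) d1)
    exact this.congr_deriv (by ring)
  have d2 : ∀ w ∈ U, deriv (deriv y) w =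
      y w * (g w ^ 2 + 2 * (g w * f w + g w * h w - f w * h w)) := fun w hw => (d2' w hw).deriv
  have hm := (H z hz).mid
  have hl := (H z hz).left
  have hr := (H z hz).right
  have d3 := (((hy z hz).fun_mul ((hm.fun_pow 2).fun_add
    (((hm.fun_mul hl).fun_add (hm.fun_mul hr)).fun_sub
      (hl.fun_mul hr) |>.const_mul 2))).congr_of_eventuallyEq
    (f₁ := deriv (deriv y)) (eventually_of_mem (hU.mem_nhds hz) d2)).deriv
  rw [iteratedDeriv_succ, iteratedDeriv_succ, iteratedDeriv_one, d3, d2 z hz, d1 z hz]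
  norm_num
  -- The factor is 16y²(yy'' − 3y'²)², because yy'' − 3y'² = 2y²(f−g)(g−h).
  linear_combination 64 * y z ^ 6 * ((f z - g z) * (g z - h z)) ^ 2 * hc z hz

end HalphenODE

/-! ### The function σ₃ on the unit disk and its Taylor series -/

section Sigma

variable {z : ℂ}

theorem one_add_re_pos (hz : ‖z‖ < 1) : 0 < (1 + z).re := by
  have := (abs_le.1 (Complex.abs_re_le_norm z)).1
  rw [Complex.add_re, Complex.one_re]
  linarith

theorem one_add_ne_zero_of_norm_lt (hz : ‖z‖ < 1) : 1 + z ≠ 0 := fun h => by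
  have := one_add_re_pos hz
  rw [h] at this
  simp at this

theorem cayley_re_pos (hz : ‖z‖ < 1) : 0 < ((1 - z) / (1 + z)).re := by
  have h := Complex.normSq_pos.2 (one_add_ne_zero_of_norm_lt hz)
  have h2 : Complex.normSq z < 1 := by
    rw [Complex.normSq_eq_norm_sq]
    nlinarith [norm_nonneg z]
  rw [Complex.div_re, ← add_div]
  refine div_pos ?_ h
  rw [Complex.normSq_apply] at h2
  simp only [Complex.sub_re, Complex.one_re, Complex.add_re, Complex.sub_im, Complex.one_im,
    Complex.add_im]
  nlinarith

/-- Both arguments lie in (−π/2, π/2), so their sum stays on the principal branch. -/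
theorem mul_cpow_of_re_pos {a b : ℂ} (ha : 0 < a.re) (hb : 0 < b.re) (c : ℂ) :
    (a * b) ^ c = a ^ c * b ^ c := by
  have ha0 : a ≠ 0 := fun h => by simp [h] at ha
  have hb0 : b ≠ 0 := fun h => by simp [h] at hb
  have h1 := abs_lt.1 (Complex.abs_arg_lt_pi_div_two_iff.2 (Or.inl ha))
  have h2 := abs_lt.1 (Complex.abs_arg_lt_pi_div_two_iff.2 (Or.inl hb))
  have hl := (Complex.log_mul_eq_add_log_iff ha0 hb0).2 ⟨by linarith, by linarith⟩
  rw [Complex.cpow_def_of_ne_zero (mul_ne_zero ha0 hb0), Complex.cpow_def_of_ne_zero ha0,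
    Complex.cpow_def_of_ne_zero hb0, hl, add_mul, Complex.exp_add]

/-- Changing the sign of `z` inverts the Cayley variable; the square root from theta inversion is
absorbed by the prefactor. -/
theorem sigma3_neg (hz : ‖z‖ < 1) : sigma3 (-z) = sigma3 z := by
  have hz' : ‖-z‖ < 1 := by rwa [norm_neg]
  have h1 := one_add_ne_zero_of_norm_lt hz
  have h2 := one_add_ne_zero_of_norm_lt hz'
  have hx := cayley_re_pos hz
  have e1 : (1 - -z) / (1 + -z) = ((1 - z) / (1 + z))⁻¹ := by
    rw [inv_div]
    ring
  have e2 : (1 + -z) = (1 - z) / (1 + z) * (1 + z) := by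
    field_simp
    ring
  have c1 : (1 + z) ^ (1 / 2 : ℂ) ≠ 0 := by simp [Complex.cpow_eq_zero_iff, h1]
  have c2 : ((1 - z) / (1 + z)) ^ (1 / 2 : ℂ) ≠ 0 := by
    have : (1 - z) / (1 + z) ≠ 0 := fun h => by simp [h] at hx
    simp [Complex.cpow_eq_zero_iff, this]
  rw [sigma3, sigma3, e1, theta3_inv hx, e2, mul_cpow_of_re_pos hx (one_add_re_pos hz)]
  field_simp

theorem differentiableOn_sigma3 : DifferentiableOn ℂ sigma3 (Metric.ball 0 1) := by
  intro z hz
  have hz : ‖z‖ < 1 := by simpa using hz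
  have h1 := one_add_ne_zero_of_norm_lt hz
  have hd : DifferentiableAt ℂ (fun z : ℂ => 1 + z) z := differentiableAt_id.const_add 1
  have hc : DifferentiableAt ℂ (fun z : ℂ => (1 + z) ^ (1 / 2 : ℂ)) z :=
    hd.cpow_const (Or.inl (one_add_re_pos hz))
  have c1 : (1 + z) ^ (1 / 2 : ℂ) ≠ 0 := by simp [Complex.cpow_eq_zero_iff, h1]
  have hm : DifferentiableAt ℂ (fun z : ℂ => (1 - z) / (1 + z)) z :=
    (differentiableAt_id.const_sub 1).div hd h1
  have ht : DifferentiableAt ℂ (fun z : ℂ => theta3 ((1 - z) / (1 + z))) z :=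
    DifferentiableAt.comp z (g := theta3) (differentiableAt_theta3 (cayley_re_pos hz)) hm
  exact (((differentiableAt_const 1).div hc c1).mul ht).differentiableWithinAt

theorem iteratedDeriv_sigma3_zero_of_odd {n : ℕ} (hn : Odd n) : iteratedDeriv n sigma3 0 = 0 := by
  have h : (fun z => sigma3 (-z)) =ᶠ[𝓝 0] sigma3 := by
    filter_upwards [Metric.ball_mem_nhds (0 : ℂ) one_pos] with z hz
    exact sigma3_neg (by simpa using hz)
  have h2 := h.iteratedDeriv_eq n
  rw [iteratedDeriv_comp_neg, neg_zero, hn.neg_one_pow, neg_one_smul] at h2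
  exact self_eq_neg.1 h2.symm

theorem hasSum_sigma3 (hz : ‖z‖ < 1) :
    HasSum (fun n : ℕ => iteratedDeriv (2 * n) sigma3 0 / ((2 * n).factorial : ℂ) * z ^ (2 * n))
      (sigma3 z) := by
  have h := Complex.hasSum_taylorSeries_on_ball differentiableOn_sigma3
    (show z ∈ Metric.ball 0 1 by simpa using hz)
  have hi : Function.Injective fun n : ℕ => 2 * n := fun a b h => by simpa using h
  rw [← hi.hasSum_iff] at h
  · refine h.congr_fun fun n => ?_
    simp only [Function.comp, sub_zero, smul_eq_mul]
    ring
  · intro m hm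
    have : Odd m := by
      rw [← Nat.not_even_iff_odd]
      rintro ⟨k, rfl⟩
      exact hm ⟨k, two_mul k⟩
    rw [iteratedDeriv_sigma3_zero_of_odd this, smul_zero, smul_zero]

theorem thetaPhi_pos : 0 < thetaPhi := by
  have := Real.Gamma_pos_of_pos (show (0 : ℝ) < 1 / 4 by norm_num)
  have := Real.pi_pos
  unfold thetaPhi
  positivity

theorem sqrt_thetaPhi_pos : 0 < Real.sqrt thetaPhi := Real.sqrt_pos.2 thetaPhi_pos

theorem sqrt_thetaPhi_sq : ((Real.sqrt thetaPhi : ℝ) : ℂ) ^ 2 = thetaPhi := by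
  rw [← Complex.ofReal_pow, Real.sq_sqrt thetaPhi_pos.le]

/-- This is where the choice of Φ matters: it makes the constant `c` in Jacobi's equation equal to
2. -/
theorem theta3_one_pow_eight_mul :
    theta3 1 ^ 8 * (Real.pi : ℂ) ^ 2 = 8 * ((Real.sqrt thetaPhi : ℝ) : ℂ) ^ 2 := by
  rw [sqrt_thetaPhi_sq, theta3_one_pow_eight, thetaPhi]
  have : (Real.pi : ℂ) ≠ 0 := Complex.ofReal_ne_zero.2 Real.pi_ne_zero
  push_cast
  field_simp
  norm_num
  ring

theorem theta3_one_ne_zero : theta3 1 ≠ 0 := theta3_ne_zero (by simp)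

theorem norm_div_sqrt_thetaPhi (hz : ‖z‖ < Real.sqrt thetaPhi) :
    ‖z / (Real.sqrt thetaPhi : ℂ)‖ < 1 := by
  rw [norm_div, Complex.norm_real, Real.norm_eq_abs, abs_of_pos sqrt_thetaPhi_pos,
    div_lt_one sqrt_thetaPhi_pos]
  exact hz

theorem hasSum_sigmaHat3 (hz : ‖z‖ < Real.sqrt thetaPhi) :
    HasSum (fun n : ℕ => thetaD n / ((2 * n).factorial : ℂ) * z ^ (2 * n))
      (1 / theta3 1 * sigma3 (z / (Real.sqrt thetaPhi : ℂ))) := by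
  refine ((hasSum_sigma3 (norm_div_sqrt_thetaPhi hz)).mul_left (1 / theta3 1)).congr_fun
    fun n => ?_
  rw [thetaD, div_pow, pow_mul ((Real.sqrt thetaPhi : ℝ) : ℂ), sqrt_thetaPhi_sq]
  have := theta3_one_ne_zero
  have : (thetaPhi : ℂ) ≠ 0 := Complex.ofReal_ne_zero.2 thetaPhi_pos.ne'
  field_simp

theorem sigmaHat3_eq (hz : ‖z‖ < Real.sqrt thetaPhi) :
    sigmaHat3 z = 1 / theta3 1 * sigma3 (z / (Real.sqrt thetaPhi : ℂ)) :=
  (hasSum_sigmaHat3 hz).tsum_eq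

end Sigma

/-! ### Transport to the disk of radius √Φ -/

section SigmaHat

/-- The Cayley transform `(1 - w)/(1 + w)` at `w = z/r`. -/
noncomputable def cayleyScaled (r z : ℂ) : ℂ := (1 - z / r) / (1 + z / r)

/-- The transform under the scaled Cayley map of a logarithmic derivative in weight `1/2`. -/
noncomputable def cayleyLogDeriv (r : ℂ) (f : ℂ → ℂ) (z : ℂ) : ℂ :=
  -2 * r / (r + z) ^ 2 * f (cayleyScaled r z) + -1 / (2 * (r + z))

variable {r z : ℂ}

theorem hasDerivAt_cayleyScaled (hr : r ≠ 0) (hz : r + z ≠ 0) :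
    HasDerivAt (cayleyScaled r) (-2 * r / (r + z) ^ 2) z := by
  have h1 : 1 + z / r ≠ 0 := by
    rw [one_add_div hr]
    exact div_ne_zero hz hr
  have hd := (hasDerivAt_id z).div_const r
  refine ((hd.const_sub 1).div (hd.const_add 1) h1).congr_deriv ?_
  simp only [id]
  field_simp
  ring

theorem IsHalphenAt.cayley {f g h : ℂ → ℂ} (hr : r ≠ 0) (hz : r + z ≠ 0)
    (H : IsHalphenAt f g h (cayleyScaled r z)) :
    IsHalphenAt (cayleyLogDeriv r f) (cayleyLogDeriv r g) (cayleyLogDeriv r h) z := by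
  have hd : HasDerivAt (fun w => r + w) 1 z := (hasDerivAt_id z).const_add r
  -- Here μ is the logarithmic derivative of (1 + w/r)^(−1/2), the prefactor of σ₃; it satisfies s''
  -- = 4μs' and μ' = 2μ².
  refine H.comp (s' := fun w => -2 * r / (r + w) ^ 2) (μ := fun w => -1 / (2 * (r + w)))
    (hasDerivAt_cayleyScaled hr hz) ?_ ?_
  · refine ((hasDerivAt_const z (-2 * r)).fun_div (hd.fun_pow 2) (pow_ne_zero 2 hz)).congr_deriv ?_
    field_simp
    norm_num
    ring
  · refine ((hasDerivAt_const z (-1 : ℂ)).fun_div (hd.const_mul 2)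
      (mul_ne_zero two_ne_zero hz)).congr_deriv ?_
    field_simp
    norm_num

theorem hasDerivAt_sigma3_div (hr : r ≠ 0) (hz : ‖z / r‖ < 1) :
    HasDerivAt (fun w => sigma3 (w / r))
      (sigma3 (z / r) * cayleyLogDeriv r (logDeriv theta3) z) z := by
  have h1 := one_add_ne_zero_of_norm_lt hz
  have hrz : r + z ≠ 0 := by
    intro h
    rw [one_add_div hr, h, zero_div] at h1
    exact h1 rfl
  have hd := ((hasDerivAt_id z).div_const r).const_add 1
  have hc := hd.cpow_const (c := (1 / 2 : ℂ)) (Or.inl (one_add_re_pos hz))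
  have c1 : (1 + z / r) ^ (1 / 2 : ℂ) ≠ 0 := by simp [Complex.cpow_eq_zero_iff, h1]
  have ht := (hasDerivAt_theta3 (cayley_re_pos hz)).comp z (hasDerivAt_cayleyScaled hr hrz)
  have := ((hasDerivAt_const z (1 : ℂ)).div hc c1).mul ht
  refine this.congr_deriv ?_
  simp only [id, Function.comp, Pi.div_apply]
  rw [Complex.cpow_sub _ _ h1, Complex.cpow_one, sigma3, cayleyLogDeriv, cayleyScaled]
  have e : 1 + z / r = (r + z) / r := by rw [one_add_div hr]
  generalize (1 + z / r) ^ (1 / 2 : ℂ) = u at c1 ⊢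
  generalize (1 - z / r) / (1 + z / r) = x
  rw [e]
  field_simp
  ring

/-- The μ terms cancel, leaving (π/2)·r/(r+z)²·θ₃⁴. Comparing its square with the eighth power on
the right gives the constant π²θ₃(1)⁸/(4r²) = 2. -/
theorem cayleyLogDeriv_sub_sq (hr : r ≠ 0) (hr2 : theta3 1 ^ 8 * (Real.pi : ℂ) ^ 2 = 8 * r ^ 2)
    (hz : ‖z / r‖ < 1) :
    (cayleyLogDeriv r (logDeriv theta2) z - cayleyLogDeriv r (logDeriv theta4) z) ^ 2 =
      2 * (1 / theta3 1 * sigma3 (z / r)) ^ 8 := by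
  have h1 := one_add_ne_zero_of_norm_lt hz
  have hrz : r + z ≠ 0 := by
    intro h
    rw [one_add_div hr, h, zero_div] at h1
    exact h1 rfl
  have h := logDeriv_theta2_sub_theta4 (cayley_re_pos hz)
  have c1 : (1 + z / r) ^ (1 / 2 : ℂ) ≠ 0 := by simp [Complex.cpow_eq_zero_iff, h1]
  have c2 : ((1 + z / r) ^ (1 / 2 : ℂ)) ^ 2 = (r + z) / r := by
    rw [← one_add_div hr, ← Complex.cpow_nat_mul]
    norm_num
  have h0 := theta3_one_ne_zero
  rw [sigma3, cayleyLogDeriv, cayleyLogDeriv, cayleyScaled]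
  generalize (1 + z / r) ^ (1 / 2 : ℂ) = u at c1 c2 ⊢
  generalize (1 - z / r) / (1 + z / r) = x at h ⊢
  have e1 : -2 * r / (r + z) ^ 2 * logDeriv theta2 x + -1 / (2 * (r + z)) -
      (-2 * r / (r + z) ^ 2 * logDeriv theta4 x + -1 / (2 * (r + z))) =
      r / (r + z) ^ 2 * (Real.pi / 2) * theta3 x ^ 4 := by
    linear_combination -2 * r / (r + z) ^ 2 * h
  have e2 : (1 / theta3 1 * (1 / u * theta3 x)) ^ 8 =
      theta3 x ^ 8 / (theta3 1 ^ 8 * (u ^ 2) ^ 4) := by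
    field_simp
  have e3 : theta3 1 ^ 8 = 8 * r ^ 2 / (Real.pi : ℂ) ^ 2 := by
    rw [eq_div_iff (pow_ne_zero 2 (Complex.ofReal_ne_zero.2 Real.pi_ne_zero)), hr2]
  have hpi : (Real.pi : ℂ) ≠ 0 := Complex.ofReal_ne_zero.2 Real.pi_ne_zero
  rw [e1, e2, e3, c2]
  field_simp
  norm_num
  ring

theorem hasDerivAt_sigmaHat3 (hz : ‖z‖ < Real.sqrt thetaPhi) :
    HasDerivAt sigmaHat3
      (sigmaHat3 z * cayleyLogDeriv (Real.sqrt thetaPhi : ℂ) (logDeriv theta3) z) z := by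
  have hr : ((Real.sqrt thetaPhi : ℝ) : ℂ) ≠ 0 := Complex.ofReal_ne_zero.2 sqrt_thetaPhi_pos.ne'
  have h := (hasDerivAt_sigma3_div hr (norm_div_sqrt_thetaPhi hz)).const_mul (1 / theta3 1)
  rw [← mul_assoc, ← sigmaHat3_eq hz] at h
  refine h.congr_of_eventuallyEq ?_
  filter_upwards [Metric.isOpen_ball.mem_nhds (mem_ball_zero_iff.2 hz)] with w hw
  exact sigmaHat3_eq (mem_ball_zero_iff.1 hw)

end SigmaHat

/-- On the disk `|z| < √Φ` the series defining `σ̂₃` converges, its sum is the rescaling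
`σ₃(z/√Φ)/θ₃(1)`, it is holomorphic, and it satisfies the nonlinear third-order equation. -/
theorem mainTheorem7 :
    (∀ z : ℂ, ‖z‖ < Real.sqrt thetaPhi →
      HasSum (fun n : ℕ => thetaD n / ((2 * n).factorial : ℂ) * z ^ (2 * n)) (sigmaHat3 z) ∧
      sigmaHat3 z = 1 / theta3 1 * sigma3 (z / (Real.sqrt thetaPhi : ℂ))) ∧
    DifferentiableOn ℂ sigmaHat3 (Metric.ball 0 (Real.sqrt thetaPhi)) ∧
    ∀ z : ℂ, ‖z‖ < Real.sqrt thetaPhi →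
      (sigmaHat3 z ^ 2 * iteratedDeriv 3 sigmaHat3 z
          - 15 * sigmaHat3 z * deriv sigmaHat3 z * iteratedDeriv 2 sigmaHat3 z
          + 30 * deriv sigmaHat3 z ^ 3) ^ 2
        + 32 * (sigmaHat3 z * iteratedDeriv 2 sigmaHat3 z - 3 * deriv sigmaHat3 z ^ 2) ^ 3
      = 32 * sigmaHat3 z ^ 10
          * (sigmaHat3 z * iteratedDeriv 2 sigmaHat3 z - 3 * deriv sigmaHat3 z ^ 2) ^ 2 := by
  refine ⟨fun z hz => ⟨(sigmaHat3_eq hz).symm ▸ hasSum_sigmaHat3 hz, sigmaHat3_eq hz⟩,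
    fun z hz => (hasDerivAt_sigmaHat3
      (mem_ball_zero_iff.1 hz)).differentiableAt.differentiableWithinAt, fun z hz => ?_⟩
  have hr : ((Real.sqrt thetaPhi : ℝ) : ℂ) ≠ 0 := Complex.ofReal_ne_zero.2 sqrt_thetaPhi_pos.ne'
  have key := jacobi_equation_of_isHalphenAt (y := sigmaHat3) (c := 2)
    (f := cayleyLogDeriv (Real.sqrt thetaPhi : ℂ) (logDeriv theta2))
    (g := cayleyLogDeriv (Real.sqrt thetaPhi : ℂ) (logDeriv theta3))
    (h := cayleyLogDeriv (Real.sqrt thetaPhi : ℂ) (logDeriv theta4))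
    (Metric.isOpen_ball (x := (0 : ℂ)) (ε := Real.sqrt thetaPhi))
    (fun w hw => hasDerivAt_sigmaHat3 (mem_ball_zero_iff.1 hw))
    (fun w hw => ?_) (fun w hw => ?_) (mem_ball_zero_iff.2 hz)
  · norm_num at key
    exact key
  · have hw := norm_div_sqrt_thetaPhi (mem_ball_zero_iff.1 hw)
    refine IsHalphenAt.cayley hr (fun h => ?_) (isHalphenAt_theta (cayley_re_pos hw))
    have h1 := one_add_ne_zero_of_norm_lt hw
    rw [one_add_div hr, h, zero_div] at h1
    exact h1 rfl
  · rw [sigmaHat3_eq (mem_ball_zero_iff.1 hw)]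
    exact cayleyLogDeriv_sub_sq hr theta3_one_pow_eight_mul
      (norm_div_sqrt_thetaPhi (mem_ball_zero_iff.1 hw))
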